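/- Let $\lambda=\{\lambda_n\}_{n=0}^\infty$ be a bounded sequence of positive real numbers and let $W_\lambda$ be the unilateral weighted shift on $\ell^2$ with $W_\lambda e_n=\lambda_n e_{n+1}$, where $\{e_n\}_{n=0}^\infty$ is the standard orthonormal basis. Put $\hat\lambda_0=1$ and $\hat\lambda_n=\lambda_0^2\cdots\lambda_{n-1}^2$ for $n\ge 1$, and let $Q_0=Q_1=0$, $Q_n(x)=\sum_{j=0}^{n-2}(n-j-1)x^j$ for $n\ge 2$. Suppose that $W_\lambda$ is conditionally positive definite (CPD), that is, for every $h\in\ell^2$ the sequence $\gamma_n=\|W_\lambda^n h\|^2$ satisfies $\sum_{i,j=0}^k\gamma_{i+j}z_i\bar z_j\ge 0$ for all $k\ge 0$ and $z_0,\dots,z_k\in\mathbb C$ with $\sum_j z_j=0$. Then there is a unique scalar representing triplet $(b,c,\nu)$ of $W_\lambda$, that is, $b\in\mathbb R$, $c\ge 0$ and a compactly supported finite Borel measure $\nu$ on $\mathbb R_+=[0,\infty)$ with $\nu(\{1\})=0$ and $$\hat\lambda_n=1+bn+cn^2+\int_{\mathbb R_+}Q_n\,d\nu,\qquad n\ge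 0;$$ and there is a unique representing triplet $(B,C,F)$ of $W_\lambda$, that is, bounded operators $B=B^*$, $C\ge 0$ on $\ell^2$ and a compactly supported semispectral measure $F$ on the Borel sets of $\mathbb R_+$ (a map into the bounded operators such that $\langle F(\cdot)h,h\rangle$ is a positive measure for every $h\in\ell^2$) with $F(\{1\})=0$ and $$W_\lambda^{*n}W_\lambda^n=I+nB+n^2C+\int_{\mathbb R_+}Q_n\,dF,\qquad n\ge 0.$$ These are related as follows. The operators $B$, $C$ and $F(\Delta)$, for every Borel set $\Delta\subseteq\mathbb R_+$, are diagonal with respect to $\{e_k\}_{k=0}^\infty$: $Be_k=b_ke_k$, $Ce_k=c_ke_k$, $F(\Delta)e_k=\nu_k(\Delta)e_k$ for all $k\ge 0$, where $$b_k=\frac{\hat\lambda_{k+1}-\hat\lambda_k-c}{\hat\lambda_k},\qquad c_k=\frac{c}{\hat\lambda_k},\qquad \nu_k(\Delta)=\frac1{\hat\lambda_k}\int_\Delta x^k\,d\nu(x).$$ Moreover, the operator $C$ is compact. -/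

import Mathlib

open scoped NNReal ENNReal ComplexOrder
open MeasureTheory

noncomputable section

namespace CPDShift

/-- A real sequence is conditionally positive definite if
`∑_{i,j ≤ k} γ_{i+j} z_i \bar{z_j} ≥ 0` for all complex `z_0, …, z_k` with `∑_j z_j = 0`. -/
def IsCPDSeq (γ : ℕ → ℝ) : Prop :=
  ∀ (k : ℕ) (z : ℕ → ℂ), ∑ j ∈ Finset.range (k + 1), z j = 0 →
    0 ≤ ∑ i ∈ Finset.range (k + 1), ∑ j ∈ Finset.range (k + 1),
      (γ (i + j) : ℂ) * z i * (starRingEnd ℂ) (z j)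

/-- The polynomials `Q_n(x) = ∑_{j=0}^{n-2} (n - j - 1) x^j`, with `Q_0 = Q_1 = 0`. -/
def Q (n : ℕ) (x : ℝ) : ℝ :=
  ∑ j ∈ Finset.range (n - 1), ((n : ℝ) - (j : ℝ) - 1) * x ^ j

section Operators

variable {H : Type*} [NormedAddCommGroup H] [InnerProductSpace ℂ H]

/-- A bounded operator `T` is conditionally positive definite if the sequence
`‖T^n h‖^2` is conditionally positive definite for every vector `h`. -/
def IsCPD (T : H →L[ℂ] H) : Prop :=
  ∀ h : H, IsCPDSeq (fun n => ‖(T ^ n) h‖ ^ 2)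

/-- `T` is diagonal with diagonal terms `ξ` with respect to `f`. -/
def IsDiagonal (T : H →L[ℂ] H) (f : ℕ → H) (ξ : ℕ → ℂ) : Prop :=
  ∀ k, T (f k) = ξ k • f k

variable (H) in
/-- A semispectral measure on `[0, ∞)`: a map from the Borel sets to the bounded operators
such that `Δ ↦ ⟨F(Δ) h, h⟩` is a (positive) measure for every vector `h`. -/
structure SemispectralMeasure where
  /-- The operator assigned to a Borel set. -/
  toFun : {Δ : Set ℝ≥0 // MeasurableSet Δ} → (H →L[ℂ] H)
  exists_measure : ∀ h : H, ∃ μ : Measure ℝ≥0, IsFiniteMeasure μ ∧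
    ∀ Δ, inner ℂ h (toFun Δ h) = ((μ.real Δ.1 : ℝ) : ℂ)

namespace SemispectralMeasure

/-- The scalar measure `⟨F(·) h, h⟩`. -/
def scalarMeasure (F : SemispectralMeasure H) (h : H) : Measure ℝ≥0 :=
  Classical.choose (F.exists_measure h)

theorem isFiniteMeasure_scalarMeasure (F : SemispectralMeasure H) (h : H) :
    IsFiniteMeasure (F.scalarMeasure h) :=
  (Classical.choose_spec (F.exists_measure h)).1

theorem inner_eq_scalarMeasure (F : SemispectralMeasure H) (h : H)
    (Δ : {Δ : Set ℝ≥0 // MeasurableSet Δ}) :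
    inner ℂ h (F.toFun Δ h) = (((F.scalarMeasure h).real Δ.1 : ℝ) : ℂ) :=
  (Classical.choose_spec (F.exists_measure h)).2 Δ

/-- `F` is compactly supported: it vanishes off some compact set. -/
def IsCompactlySupported (F : SemispectralMeasure H) : Prop :=
  ∃ (K : Set ℝ≥0) (hK : IsCompact K), F.toFun ⟨Kᶜ, hK.measurableSet.compl⟩ = 0

/-- `A = ∫ f dF`, i.e. `A` is the bounded operator such that
`⟨A h, h⟩ = ∫ f d⟨F(·) h, h⟩` for every vector `h`. -/
def HasIntegral (F : SemispectralMeasure H) (f : ℝ≥0 → ℝ) (A : H →L[ℂ] H) : Prop :=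
  ∀ h : H, Integrable f (F.scalarMeasure h) ∧
    inner ℂ h (A h) = ((∫ x, f x ∂(F.scalarMeasure h) : ℝ) : ℂ)

end SemispectralMeasure

/-- `(B, C, F)` is a representing triplet of the operator `T`:
`T^{*n} T^n = I + n B + n^2 C + ∫ Q_n dF` for all `n`, where `B = B^*`, `C ≥ 0` and `F` is a
compactly supported semispectral measure with `F({1}) = 0`. -/
structure IsRepresentingTriplet [CompleteSpace H] (T B C : H →L[ℂ] H)
    (F : SemispectralMeasure H) : Prop where
  isSelfAdjoint : IsSelfAdjoint B
  isPositive : C.IsPositive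
  compactSupport : F.IsCompactlySupported
  singleton_one : F.toFun ⟨{1}, measurableSet_singleton 1⟩ = 0
  formula : ∀ n : ℕ, ∃ A : H →L[ℂ] H, F.HasIntegral (fun x => Q n x) A ∧
    (ContinuousLinearMap.adjoint T) ^ n * T ^ n
      = 1 + (n : ℂ) • B + ((n : ℂ) ^ 2) • C + A

end Operators

/-- `(b, c, ν)` is a representing triplet, with `ν` living on `[0, ∞)`, of the real sequence `γ`:
`γ_n = γ_0 + b n + c n^2 + ∫ Q_n dν` for all `n`, where `c ≥ 0` and `ν` is a compactly supported
finite Borel measure on `[0, ∞)` with `ν({1}) = 0`. -/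
structure IsScalarTriplet (γ : ℕ → ℝ) (b c : ℝ) (ν : Measure ℝ≥0) : Prop where
  nonneg : 0 ≤ c
  finite : IsFiniteMeasure ν
  compactSupport : ∃ K : Set ℝ≥0, IsCompact K ∧ ν Kᶜ = 0
  singleton_one : ν {1} = 0
  formula : ∀ n : ℕ, γ n = γ 0 + b * n + c * (n : ℝ) ^ 2 + ∫ x, Q n (x : ℝ) ∂ν

/-- The Hilbert space of square summable complex sequences. -/
abbrev Ell2 : Type := lp (fun _ : ℕ => ℂ) 2

/-- The standard orthonormal basis of `ℓ²`. -/
def e (k : ℕ) : Ell2 := lp.single 2 k (1 : ℂ)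

/-- The coordinates of the weighted shift of a sequence: `(0, w_0 f_0, w_1 f_1, …)`. -/
def shiftFun (w : ℕ → ℝ) (f : ℕ → ℂ) : ℕ → ℂ
  | 0 => 0
  | n + 1 => (w n : ℂ) * f n

theorem shift_bound {w : ℕ → ℝ} {M : ℝ} (hM : ∀ n, |w n| ≤ M) (f : Ell2) :
    (Summable fun n => ‖shiftFun w f n‖ ^ (2 : ℝ)) ∧
      ∑' n, ‖shiftFun w f n‖ ^ (2 : ℝ) ≤ (M * ‖f‖) ^ (2 : ℝ) := by
  have hM0 : 0 ≤ M := (abs_nonneg _).trans (hM 0)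
  have h2 : (0 : ℝ) < (2 : ℝ≥0∞).toReal := by norm_num
  have hf : Summable fun n => ‖f n‖ ^ (2 : ℝ) := by
    simpa using (lp.memℓp f).summable h2
  have hle : ∀ n, ‖shiftFun w f (n + 1)‖ ^ (2 : ℝ) ≤ M ^ (2 : ℝ) * ‖f n‖ ^ (2 : ℝ) := by
    intro n
    rw [← Real.mul_rpow hM0 (norm_nonneg _)]
    refine Real.rpow_le_rpow (norm_nonneg _) ?_ (by norm_num)
    simp only [shiftFun, norm_mul, Complex.norm_real, Real.norm_eq_abs]
    exact mul_le_mul_of_nonneg_right (hM n) (norm_nonneg _)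
  have hs1 : Summable fun n => ‖shiftFun w f (n + 1)‖ ^ (2 : ℝ) :=
    Summable.of_nonneg_of_le (fun n => by positivity) hle (hf.mul_left _)
  have hs : Summable fun n => ‖shiftFun w f n‖ ^ (2 : ℝ) :=
    (summable_nat_add_iff 1).1 hs1
  refine ⟨hs, ?_⟩
  rw [hs.tsum_eq_zero_add, Real.mul_rpow hM0 (norm_nonneg _)]
  have hn : ‖f‖ ^ (2 : ℝ) = ∑' n, ‖f n‖ ^ (2 : ℝ) := by
    simpa using lp.norm_rpow_eq_tsum h2 f
  rw [hn, ← tsum_mul_left]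
  have h0 : ‖shiftFun w f 0‖ ^ (2 : ℝ) = 0 := by simp [shiftFun]
  rw [h0, zero_add]
  exact hs1.tsum_le_tsum hle (hf.mul_left _)

theorem exists_bound {w : ℕ → ℝ} (hw : Bornology.IsBounded (Set.range w)) :
    ∃ M, ∀ n, |w n| ≤ M := by
  obtain ⟨M, hM⟩ := hw.exists_norm_le
  exact ⟨M, fun n => hM _ ⟨n, rfl⟩⟩

/-- The weighted shift on `ℓ²` with the bounded sequence of weights `w`. -/
def weightedShift (w : ℕ → ℝ) (hw : Bornology.IsBounded (Set.range w)) : Ell2 →L[ℂ] Ell2 :=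
  LinearMap.mkContinuousOfExistsBound
    { toFun := fun f => ⟨shiftFun w f, by
        obtain ⟨M, hM⟩ := exists_bound hw
        exact memℓp_gen (by simpa using (shift_bound hM f).1)⟩
      map_add' := fun f g => by
        ext n
        change shiftFun w (f + g : Ell2) n = shiftFun w f n + shiftFun w g n
        cases n <;> simp [shiftFun, mul_add]
      map_smul' := fun a f => by
        ext n
        cases n <;> simp [shiftFun, mul_left_comm] }
    (by
      obtain ⟨M, hM⟩ := exists_bound hw
      refine ⟨M, fun f => ?_⟩
      have hM0 : 0 ≤ M := (abs_nonneg _).trans (hM 0)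
      refine lp.norm_le_of_tsum_le (by norm_num) (by positivity) ?_
      simpa using (shift_bound hM f).2)

/-- The defining property `W e_n = w_n e_{n+1}`. -/
theorem weightedShift_e (w : ℕ → ℝ) (hw : Bornology.IsBounded (Set.range w)) (n : ℕ) :
    weightedShift w hw (e n) = (w n : ℂ) • e (n + 1) := by
  ext k
  change shiftFun w (e n) k = (w n : ℂ) * e (n + 1) k
  cases k with
  | zero => simp [shiftFun, e]
  | succ k =>
    by_cases h : k = n
    · subst h; simp [shiftFun, e]
    · simp [shiftFun, e, h]

/-- The sequence associated with the weights: `1` for `n = 0` and `w_0^2 ⋯ w_{n-1}^2` for `n ≥ 1`. -/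
def hat (w : ℕ → ℝ) (n : ℕ) : ℝ := ∏ i ∈ Finset.range n, w i ^ 2

end CPDShift

end

noncomputable section

namespace CPDShift

open Polynomial Filter Topology

/-! ### The Hausdorff moment problem by Bernstein polynomials. -/

section Moments

/-! Since ‖W^n e_k‖² = `hat w (k + n) / hat w k`, the hypothesis on the basis vectors alone makes
every shift n ↦ `hat w (n + k)` CPD. Let Λ be the functional with Λ(x^n) = `hat w n`. Then Λ(x^k q²)
≥ 0 for every real polynomial q with q(1) = 0, so L(p) = Λ((x - 1)² p) is nonnegative on x^k (R -
x)^{2m}. When R bounds the exponential growth of `hat w`, this puts L under the Hausdorff moment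
theorem on [0, R]: the second differences of `hat w` are the moments of a measure μ. Its atom at 1
has mass 2c, the rest is ν, and Q_n, whose second difference is x^n, carries out the double
summation (`exists_isScalarTriplet`). Conversely a triplet gives back μ = ν + 2cδ₁, which its
moments determine (`IsScalarTriplet.unique`).

W*^n W^n is diagonal with entries `hat w (k + n) / hat w k`. Restarting the scalar formula at index
k replaces ν by x^k ν and produces b_k, c_k, ν_k. They are bounded in k because the ratios are, so
they define an operator triplet (`IsScalarTriplet.exists_isRepresentingTriplet`). Pairing with a
vector turns an operator triplet into a scalar one, so operator triplets are unique too and the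
diagonal one is the only one. If c > 0, `hat w` grows at least quadratically, so c_k → 0 and C is
compact. -/

theorem sum_choose_smul_bernsteinPolynomial (k m : ℕ) :
    ∑ j ∈ Finset.range (k + m + 1), (j.choose k : ℝ) • bernsteinPolynomial ℝ (k + m) j
      = ((k + m).choose k : ℝ) • X ^ k := by
  rw [add_assoc, Finset.sum_range_add, Finset.sum_eq_zero, zero_add]
  · have h : ∀ i ∈ Finset.range (m + 1),
        ((k + i).choose k : ℝ) • bernsteinPolynomial ℝ (k + m) (k + i)
          = (((k + m).choose k : ℝ) • X ^ k) * bernsteinPolynomial ℝ m i := by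
      intro i _
      -- This identity pulls out C(k+m,k) x^k and leaves the Bernstein polynomials of degree m,
      -- which sum to 1.
      have hc : ((k + m).choose (k + i) : ℝ) * ((k + i).choose k : ℝ)
          = ((k + m).choose k : ℝ) * (m.choose i : ℝ) := by
        have := Nat.choose_mul (n := k + m) (k := k + i) (s := k) (by omega)
        rw [Nat.add_sub_cancel_left, Nat.add_sub_cancel_left] at this
        exact_mod_cast this
      have hs : k + m - (k + i) = m - i := by omega
      have hc' := congrArg (Polynomial.C : ℝ → ℝ[X]) hc
      simp only [map_mul, map_natCast] at hc'
      simp only [bernsteinPolynomial, hs, smul_eq_C_mul, map_natCast, pow_add]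
      linear_combination (X ^ k * X ^ i * (1 - X) ^ (m - i)) * hc'
    rw [Finset.sum_congr rfl h, ← Finset.mul_sum, bernsteinPolynomial.sum, mul_one]
  · intro j hj
    rw [Nat.choose_eq_zero_of_lt (Finset.mem_range.1 hj)]
    simp

/-- The ratio of binomial coefficients `C(j,k)/C(n,k)` is `(j/n)^k` up to `O(1/n)`. -/
theorem exists_abs_choose_div_sub_pow_le (k : ℕ) :
    ∃ K : ℝ, 0 ≤ K ∧ ∀ n j : ℕ, k < n → j ≤ n →
      |(j.choose k : ℝ) / (n.choose k : ℝ) - ((j : ℝ) / n) ^ k| ≤ K / n := by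
  induction k with
  | zero => exact ⟨0, le_rfl, fun n j _ _ => by simp⟩
  | succ k ih =>
    obtain ⟨K, hK, h⟩ := ih
    -- Passing from k to k + 1 multiplies by (j-k)/(n-k) instead of j/n. These differ by at most
    -- k(k+1)/n, and the remaining factors are at most 1.
    refine ⟨k * (k + 1) + K, by positivity, fun n j hn hj => ?_⟩
    have hkn : k < n := by omega
    have hnk : (0 : ℝ) < (n : ℝ) - k := sub_pos.2 (by exact_mod_cast hkn)
    have hn0 : (0 : ℝ) < n := by exact_mod_cast (by omega : 0 < n)
    have hjn : (j : ℝ) ≤ n := by exact_mod_cast hj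
    have hstep : ∀ a : ℕ, (a.choose (k + 1) : ℝ) * (k + 1) = a.choose k * ((a : ℝ) - k) := by
      intro a
      by_cases ha : k ≤ a
      · have := Nat.choose_succ_right_eq a k
        rw [← Nat.cast_sub ha]
        exact_mod_cast this
      · rw [Nat.choose_eq_zero_of_lt (by omega), Nat.choose_eq_zero_of_lt (by omega)]
        simp
    have hcn : (0 : ℝ) < n.choose k := by exact_mod_cast Nat.choose_pos hkn.le
    have hcn' : (0 : ℝ) < n.choose (k + 1) := by exact_mod_cast Nat.choose_pos (by omega)
    have hr : (j.choose (k + 1) : ℝ) / n.choose (k + 1)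
        = (j.choose k : ℝ) / n.choose k * (((j : ℝ) - k) / ((n : ℝ) - k)) := by
      rw [div_mul_div_comm, div_eq_div_iff hcn'.ne' (by positivity), ← hstep n]
      linear_combination (n.choose (k + 1) : ℝ) * hstep j
    have hr1 : |(j.choose k : ℝ) / n.choose k| ≤ 1 := by
      rw [abs_of_nonneg (by positivity), div_le_one hcn]
      exact_mod_cast Nat.choose_le_choose k hj
    have hd : |((j : ℝ) - k) / ((n : ℝ) - k) - (j : ℝ) / n| ≤ k * (k + 1) / n := by
      have : ((j : ℝ) - k) / ((n : ℝ) - k) - (j : ℝ) / n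
          = -(k * ((n : ℝ) - j) / ((n - k) * n)) := by
        field_simp
        ring
      rw [this, abs_neg, abs_of_nonneg
        (div_nonneg (mul_nonneg (Nat.cast_nonneg _) (by linarith)) (by positivity)),
        div_le_div_iff₀ (by positivity) hn0]
      have h1 : (n : ℝ) ≤ (k + 1) * (n - k) := by
        have : (k : ℝ) + 1 ≤ n := by exact_mod_cast hkn
        nlinarith [(Nat.cast_nonneg k : (0 : ℝ) ≤ k)]
      have h2 : (n : ℝ) - j ≤ (k + 1) * (n - k) := by
        linarith [(Nat.cast_nonneg j : (0 : ℝ) ≤ j)]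
      have h3 : (k : ℝ) * n * (n - j) ≤ k * n * ((k + 1) * (n - k)) :=
        mul_le_mul_of_nonneg_left h2 (by positivity)
      linarith
    have hj1 : |(j : ℝ) / n| ≤ 1 := by
      rw [abs_of_nonneg (by positivity)]
      exact div_le_one_of_le₀ hjn hn0.le
    have hsplit : (j.choose (k + 1) : ℝ) / n.choose (k + 1) - ((j : ℝ) / n) ^ (k + 1)
        = (j.choose k : ℝ) / n.choose k * (((j : ℝ) - k) / ((n : ℝ) - k) - (j : ℝ) / n)
          + ((j.choose k : ℝ) / n.choose k - ((j : ℝ) / n) ^ k) * ((j : ℝ) / n) := by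
      rw [hr]; ring
    rw [hsplit, add_div]
    refine (abs_add_le _ _).trans (add_le_add ?_ ?_)
    · rw [abs_mul]
      exact (mul_le_of_le_one_left (abs_nonneg _) hr1).trans hd
    · rw [abs_mul]
      exact (mul_le_of_le_one_right (abs_nonneg _) hj1).trans (h n j hkn hj)

/-- A bounded convex sequence is nonincreasing. -/
theorem succ_le_of_convex_of_bounded {a : ℕ → ℝ} {M : ℝ} (hM : ∀ n, a n ≤ M)
    (hconv : ∀ n, 0 ≤ a n - 2 * a (n + 1) + a (n + 2)) (n : ℕ) : a (n + 1) ≤ a n := by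
  by_contra! hlt
  -- Increments of a convex sequence never decrease, so a single positive one forces linear growth.
  have h1 : ∀ m, a (n + 1) - a n ≤ a (n + m + 1) - a (n + m) := by
    intro m
    induction m with
    | zero => simp
    | succ m ih =>
      have := hconv (n + m)
      rw [show n + (m + 1) + 1 = n + m + 2 by ring, show n + (m + 1) = n + m + 1 by ring]
      linarith
  have h2 : ∀ m : ℕ, a n + m * (a (n + 1) - a n) ≤ a (n + m) := by
    intro m
    induction m with
    | zero => simp
    | succ m ih =>
      have := h1 m
      push_cast
      rw [show n + (m + 1) = n + m + 1 by ring]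
      linarith
  obtain ⟨m, hm⟩ := exists_nat_gt ((M - a n) / (a (n + 1) - a n))
  rw [div_lt_iff₀ (by linarith)] at hm
  linarith [h2 m, hM (n + m)]

variable (L : ℝ[X] →ₗ[ℝ] ℝ)

theorem exists_bound_apply_mul {M : ℝ} (hM : ∀ n, |L (X ^ n)| ≤ M) (p : ℝ[X]) :
    ∃ K, ∀ n, |L (X ^ n * p)| ≤ K := by
  induction p using Polynomial.induction_on' with
  | add p q hp hq =>
    obtain ⟨K, hK⟩ := hp
    obtain ⟨K', hK'⟩ := hq
    refine ⟨K + K', fun n => ?_⟩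
    rw [mul_add, map_add]
    exact (abs_add_le _ _).trans (add_le_add (hK n) (hK' n))
  | monomial m r =>
    refine ⟨|r| * M, fun n => ?_⟩
    have : (X : ℝ[X]) ^ n * monomial m r = r • X ^ (n + m) := by
      rw [← C_mul_X_pow_eq_monomial, smul_eq_C_mul]; ring
    rw [this, map_smul, smul_eq_mul, abs_mul]
    exact mul_le_mul_of_nonneg_left (hM _) (abs_nonneg _)

/-- For odd exponents, n ↦ L(x^n (1-x)^{2r}) is bounded and its second difference L(x^n
(1-x)^{2r+2}) is nonnegative. It is therefore nonincreasing, which is the claim for 2r + 1. -/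
theorem apply_pow_mul_one_sub_pow_nonneg {M : ℝ} (hM : ∀ n, |L (X ^ n)| ≤ M)
    (hL : ∀ k m, 0 ≤ L (X ^ k * (1 - X) ^ (2 * m))) (k m : ℕ) :
    0 ≤ L (X ^ k * (1 - X) ^ m) := by
  obtain ⟨r, rfl | rfl⟩ := Nat.even_or_odd' m
  · exact hL k r
  · obtain ⟨K, hK⟩ := exists_bound_apply_mul L hM ((1 - X) ^ (2 * r))
    have h := succ_le_of_convex_of_bounded (a := fun n => L (X ^ n * (1 - X) ^ (2 * r)))
      (fun n => (le_abs_self _).trans (hK n)) (fun n => by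
        have h := hL n (r + 1)
        rw [show (X : ℝ[X]) ^ n * (1 - X) ^ (2 * (r + 1)) = X ^ n * (1 - X) ^ (2 * r)
          - (2 : ℝ) • (X ^ (n + 1) * (1 - X) ^ (2 * r)) + X ^ (n + 2) * (1 - X) ^ (2 * r) by
            rw [smul_eq_C_mul]; simp only [map_ofNat]; ring] at h
        simpa using h) k
    rw [show (X : ℝ[X]) ^ k * (1 - X) ^ (2 * r + 1) = X ^ k * (1 - X) ^ (2 * r)
      - X ^ (k + 1) * (1 - X) ^ (2 * r) by ring, map_sub]
    exact sub_nonneg.2 h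

theorem apply_bernsteinPolynomial_nonneg {M : ℝ} (hM : ∀ n, |L (X ^ n)| ≤ M)
    (hL : ∀ k m, 0 ≤ L (X ^ k * (1 - X) ^ (2 * m))) (n j : ℕ) :
    0 ≤ L (bernsteinPolynomial ℝ n j) := by
  have : bernsteinPolynomial ℝ n j = (n.choose j : ℝ) • (X ^ j * (1 - X) ^ (n - j)) := by
    rw [bernsteinPolynomial, smul_eq_C_mul, map_natCast, mul_assoc]
  rw [this, map_smul]
  exact mul_nonneg (Nat.cast_nonneg _) (apply_pow_mul_one_sub_pow_nonneg L hM hL _ _)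

theorem sum_apply_bernsteinPolynomial (n : ℕ) :
    ∑ j ∈ Finset.range (n + 1), L (bernsteinPolynomial ℝ n j) = L 1 := by
  rw [← map_sum, bernsteinPolynomial.sum]

/-- The weights L(B_{n,j}) integrate C(j,k)/C(n,k) exactly to L(x^k). Replacing this ratio by
(j/n)^k costs at most K/n times the total weight L(1). -/
theorem tendsto_sum_pow_mul_apply_bernsteinPolynomial {M : ℝ} (hM : ∀ n, |L (X ^ n)| ≤ M)
    (hL : ∀ k m, 0 ≤ L (X ^ k * (1 - X) ^ (2 * m))) (k : ℕ) :
    Tendsto (fun n : ℕ => ∑ j ∈ Finset.range (n + 1),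
      L (bernsteinPolynomial ℝ n j) * ((j : ℝ) / n) ^ k) atTop (𝓝 (L (X ^ k))) := by
  obtain ⟨K, hK0, hK⟩ := exists_abs_choose_div_sub_pow_le k
  have hlim : Tendsto (fun n : ℕ => L 1 * K / n) atTop (𝓝 0) :=
    tendsto_const_div_atTop_nhds_zero_nat _
  refine tendsto_iff_dist_tendsto_zero.2 (squeeze_zero' (Eventually.of_forall fun _ => dist_nonneg)
    ?_ hlim)
  filter_upwards [eventually_gt_atTop k] with n hn
  have hid : L (X ^ k) = ∑ j ∈ Finset.range (n + 1),
      L (bernsteinPolynomial ℝ n j) * ((j.choose k : ℝ) / n.choose k) := by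
    obtain ⟨m, rfl⟩ := Nat.exists_eq_add_of_le hn.le
    have h := congrArg L (sum_choose_smul_bernsteinPolynomial k m)
    have hc : ((k + m).choose k : ℝ) ≠ 0 := by
      exact_mod_cast (Nat.choose_pos (Nat.le_add_right k m)).ne'
    rw [map_sum, map_smul, smul_eq_mul] at h
    rw [← mul_right_inj' hc, ← h, Finset.mul_sum]
    refine Finset.sum_congr rfl fun j _ => ?_
    rw [map_smul, smul_eq_mul]
    field_simp
  rw [dist_comm, Real.dist_eq, hid, ← Finset.sum_sub_distrib]
  refine (Finset.abs_sum_le_sum_abs _ _).trans ?_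
  rw [← sum_apply_bernsteinPolynomial L n, mul_div_assoc, Finset.sum_mul]
  refine Finset.sum_le_sum fun j hj => ?_
  have hnn := apply_bernsteinPolynomial_nonneg L hM hL n j
  rw [← mul_sub, abs_mul, abs_of_nonneg hnn]
  exact mul_le_mul_of_nonneg_left (hK n j hn (by have := Finset.mem_range.1 hj; omega)) hnn

/-- Hausdorff moment problem: if the functional `L` has bounded moments and is nonnegative on
`x^k (1-x)^{2m}`, then it is given by a measure on `[0,1]`. -/
theorem exists_measure_unitInterval {M : ℝ} (hM : ∀ n, |L (X ^ n)| ≤ M)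
    (hL : ∀ k m, 0 ≤ L (X ^ k * (1 - X) ^ (2 * m))) :
    ∃ μ : FiniteMeasure unitInterval,
      ∀ k : ℕ, ∫ x, (x : ℝ) ^ k ∂(μ : Measure unitInterval) = L (X ^ k) := by
  let c : ℕ → ℕ → ℝ≥0 := fun n j => (L (bernsteinPolynomial ℝ n j)).toNNReal
  have hc : ∀ n j, (c n j : ℝ) = L (bernsteinPolynomial ℝ n j) := fun n j =>
    Real.coe_toNNReal _ (apply_bernsteinPolynomial_nonneg L hM hL n j)
  let pt : ℕ → ℕ → unitInterval := fun n j => Set.projIcc 0 1 zero_le_one ((j : ℝ) / n)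
  -- Atoms L(B_{n,j}) at j/n. The total mass is always L(1), so compactness supplies a limit measure
  -- along an ultrafilter.
  let μ' : ℕ → Measure unitInterval := fun n =>
    ∑ j ∈ Finset.range (n + 1), (c n j) • Measure.dirac (pt n j)
  have hfin : ∀ n, IsFiniteMeasure (μ' n) := fun n => inferInstance
  let μ : ℕ → FiniteMeasure unitInterval := fun n => ⟨μ' n, hfin n⟩
  have hint : ∀ (n : ℕ) (f : C(unitInterval, ℝ)), ∫ x, f x ∂(μ' n)
      = ∑ j ∈ Finset.range (n + 1), L (bernsteinPolynomial ℝ n j) * f (pt n j) := by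
    intro n f
    rw [integral_finsetSum_measure]
    · refine Finset.sum_congr rfl fun j _ => ?_
      rw [integral_smul_nnreal_measure, integral_dirac, NNReal.smul_def, hc, smul_eq_mul]
    · intro j _
      exact (f.continuous.integrable_of_hasCompactSupport
        (HasCompactSupport.of_compactSpace f))
  have hmass : ∀ n, (μ n).mass ≤ (L 1).toNNReal := by
    intro n
    have h1 := hint n 1
    rw [← NNReal.coe_le_coe]
    simp only [ContinuousMap.one_apply, mul_one, sum_apply_bernsteinPolynomial] at h1
    have h2 : (((μ n).mass : ℝ≥0) : ℝ) = L 1 := by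
      rw [← h1]; simp [FiniteMeasure.mass, μ, Measure.real]; rfl
    rw [h2]; exact Real.le_coe_toNNReal _
  have hcomp := isCompact_setOfPred_finiteMeasure_le_of_compactSpace (E := unitInterval)
    ((L 1).toNNReal)
  obtain ⟨ρ, -, hρ⟩ := hcomp.ultrafilter_le_nhds ((hyperfilter ℕ).map μ)
    (by
      rw [le_principal_iff, Ultrafilter.coe_map, mem_map]
      exact Eventually.of_forall hmass)
  have hρ' : Tendsto μ (hyperfilter ℕ) (𝓝 ρ) := hρ
  refine ⟨ρ, fun k => ?_⟩
  let f : C(unitInterval, ℝ) := ⟨fun x => (x : ℝ) ^ k, by fun_prop⟩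
  have h1 := (FiniteMeasure.tendsto_iff_forall_integral_tendsto.1 hρ')
    (BoundedContinuousFunction.mkOfCompact f)
  have h2 := (tendsto_sum_pow_mul_apply_bernsteinPolynomial L hM hL k).mono_left
    (Nat.hyperfilter_le_atTop)
  refine tendsto_nhds_unique h1 (h2.congr fun n => ?_)
  change _ = ∫ x, f x ∂(μ' n)
  rw [hint]
  refine Finset.sum_congr rfl fun j hj => ?_
  have hjn : (j : ℝ) / n ∈ Set.Icc (0 : ℝ) 1 :=
    ⟨by positivity, div_le_one_of_le₀
      (by exact_mod_cast Nat.lt_succ_iff.1 (Finset.mem_range.1 hj)) (by positivity)⟩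
  simp only [pt, f, ContinuousMap.coe_mk]
  rw [Set.projIcc_of_mem zero_le_one hjn]

/-- The moment problem on `[0,R]`. -/
theorem exists_measure_of_growth {M R : ℝ} (hR : 0 < R) (hM : ∀ n, |L (X ^ n)| ≤ M * R ^ n)
    (hL : ∀ k m, 0 ≤ L (X ^ k * (C R - X) ^ (2 * m))) :
    ∃ μ : Measure ℝ≥0, IsFiniteMeasure μ ∧ (∃ K : Set ℝ≥0, IsCompact K ∧ μ Kᶜ = 0) ∧
      ∀ k : ℕ, ∫ x, (x : ℝ) ^ k ∂μ = L (X ^ k) := by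
  -- Rescaling x to x/R turns R - x into a multiple of 1 - x and makes the moments bounded. The
  -- measure is pushed back by x ↦ Rx.
  let L' : ℝ[X] →ₗ[ℝ] ℝ := L ∘ₗ (aeval (C R⁻¹ * X : ℝ[X])).toLinearMap
  have hL'X : ∀ n, L' (X ^ n) = (R⁻¹) ^ n * L (X ^ n) := by
    intro n
    simp only [L', LinearMap.comp_apply, AlgHom.toLinearMap_apply, map_pow, aeval_X, mul_pow]
    rw [← map_pow, ← smul_eq_C_mul, map_smul, smul_eq_mul]
  obtain ⟨μ, hμ⟩ := exists_measure_unitInterval L' (M := M)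
    (fun n => by
      rw [hL'X, abs_mul, abs_of_nonneg (by positivity), inv_pow, inv_mul_le_iff₀ (by positivity),
        mul_comm]
      exact hM n)
    (fun k m => by
      have h : aeval (C R⁻¹ * X : ℝ[X]) (X ^ k * (1 - X) ^ (2 * m) : ℝ[X])
          = ((R⁻¹) ^ k * (R⁻¹) ^ (2 * m)) • (X ^ k * (C R - X) ^ (2 * m)) := by
        have h1 : (1 : ℝ[X]) - C R⁻¹ * X = C R⁻¹ * (C R - X) := by
          rw [mul_sub, ← C_mul, inv_mul_cancel₀ hR.ne', C_1]
        simp only [map_mul, map_pow, map_sub, map_one, aeval_X, h1, smul_eq_C_mul, mul_pow]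
        ring
      simp only [L', LinearMap.comp_apply, AlgHom.toLinearMap_apply, h, map_smul, smul_eq_mul]
      exact mul_nonneg (by positivity) (hL k m))
  let g : unitInterval → ℝ≥0 := fun x => R.toNNReal * unitInterval.toNNReal x
  have hg : Continuous g := by fun_prop
  refine ⟨(μ : Measure unitInterval).map g, inferInstance, ⟨Set.range g, isCompact_range hg, ?_⟩,
    fun k => ?_⟩
  · rw [Measure.map_apply hg.measurable (isCompact_range hg).measurableSet.compl]
    simp
  · rw [integral_map hg.measurable.aemeasurable (by fun_prop)]
    have : ∀ x : unitInterval, ((g x : ℝ≥0) : ℝ) ^ k = R ^ k * (x : ℝ) ^ k := by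
      intro x
      simp [g, hR.le, mul_pow]
    simp_rw [this]
    rw [integral_const_mul, hμ, hL'X, ← mul_assoc, ← mul_pow, mul_inv_cancel₀ hR.ne', one_pow,
      one_mul]

end Moments

/-! ### Determinacy of compactly supported measures by Weierstrass approximation. -/

section Determinacy

theorem integrable_of_compactSupport {X : Type*} [TopologicalSpace X] [T2Space X]
    [MeasurableSpace X] [OpensMeasurableSpace X]
    {μ : Measure X} [IsFiniteMeasure μ] {K : Set X} (hK : IsCompact K) (hμ : μ Kᶜ = 0)
    {f : X → ℝ} (hf : Continuous f) : Integrable f μ := by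
  rw [← Measure.restrict_eq_self_of_ae_mem (s := K) (μ := μ) (mem_ae_iff.2 hμ)]
  exact hf.continuousOn.integrableOn_compact hK

/-- Compactly supported finite measures on `[0,∞)` are determined by their moments. -/
theorem measure_eq_of_moments {μ ν : Measure ℝ≥0} [IsFiniteMeasure μ] [IsFiniteMeasure ν]
    (hμ : ∃ K : Set ℝ≥0, IsCompact K ∧ μ Kᶜ = 0) (hν : ∃ K : Set ℝ≥0, IsCompact K ∧ ν Kᶜ = 0)
    (h : ∀ k : ℕ, ∫ x, (x : ℝ) ^ k ∂μ = ∫ x, (x : ℝ) ^ k ∂ν) : μ = ν := by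
  obtain ⟨K, hK, hμK⟩ := hμ
  obtain ⟨K', hK', hνK'⟩ := hν
  obtain ⟨R, hR⟩ := (hK.union hK').bddAbove
  have hμR : ∀ᵐ x ∂μ, x ≤ R :=
    (show ∀ᵐ x ∂μ, x ∈ K from mem_ae_iff.2 hμK).mono fun x hx => hR (Or.inl hx)
  have hνR : ∀ᵐ x ∂ν, x ≤ R :=
    (show ∀ᵐ x ∂ν, x ∈ K' from mem_ae_iff.2 hνK').mono fun x hx => hR (Or.inr hx)
  have hpoly : ∀ p : ℝ[X], ∫ x : ℝ≥0, p.eval (x : ℝ) ∂μ = ∫ x : ℝ≥0, p.eval (x : ℝ) ∂ν := by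
    intro p
    simp_rw [eval_eq_sum_range]
    rw [integral_finsetSum _ fun i _ => integrable_of_compactSupport hK hμK (by fun_prop),
      integral_finsetSum _ fun i _ => integrable_of_compactSupport hK' hνK' (by fun_prop)]
    simp_rw [integral_const_mul, h]
  refine ext_of_forall_integral_eq_of_IsFiniteMeasure fun f => ?_
  refine eq_of_forall_dist_le fun ε hε => ?_
  -- The added 1 keeps the divisor positive when both measures vanish.
  set m := μ.real Set.univ + ν.real Set.univ + 1 with hm
  have hm0 : 0 < m := by positivity
  obtain ⟨p, hp⟩ := exists_polynomial_near_of_continuousOn 0 (R : ℝ)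
    (fun x => f x.toNNReal) (by fun_prop) (ε / m) (by positivity)
  have key : ∀ (ρ : Measure ℝ≥0) [IsFiniteMeasure ρ], (∀ᵐ x ∂ρ, x ≤ R) →
      Integrable (fun x : ℝ≥0 => p.eval (x : ℝ)) ρ →
      |∫ x, f x ∂ρ - ∫ x : ℝ≥0, p.eval (x : ℝ) ∂ρ| ≤ ε / m * ρ.real Set.univ := by
    intro ρ _ hρ hi
    rw [← integral_sub (f.integrable ρ) hi, ← Real.norm_eq_abs]
    refine norm_integral_le_of_norm_le_const (hρ.mono fun x hx => ?_)
    have := hp x ⟨x.2, by exact_mod_cast hx⟩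
    rw [Real.toNNReal_coe] at this
    rw [norm_sub_rev]
    exact this.le
  have h1 := key μ hμR (integrable_of_compactSupport hK hμK (by fun_prop))
  have h2 := key ν hνR (integrable_of_compactSupport hK' hνK' (by fun_prop))
  rw [hpoly p] at h1
  rw [Real.dist_eq]
  calc |∫ x, f x ∂μ - ∫ x, f x ∂ν| ≤ ε / m * μ.real Set.univ + ε / m * ν.real Set.univ := by
        refine (abs_sub_le _ _ _).trans (add_le_add h1 ?_)
        rw [abs_sub_comm]; exact h2
    _ = ε / m * (m - 1) := by rw [hm]; ring
    _ ≤ ε := by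
        rw [mul_sub, div_mul_cancel₀ _ hm0.ne', mul_one]
        have : 0 < ε / m := by positivity
        linarith

end Determinacy

end CPDShift

namespace CPDShift

open Polynomial Filter Topology

/-! ### Second differences and scalar triplets. -/

section Scalar

/-- The extra term j = n - 1 has coefficient zero; including it removes the truncated subtraction.
-/
theorem Q_eq_sum_range (n : ℕ) (x : ℝ) :
    Q n x = ∑ j ∈ Finset.range n, ((n : ℝ) - (j : ℝ) - 1) * x ^ j := by
  cases n with
  | zero => simp [Q]
  | succ n => rw [Finset.sum_range_succ]; simp [Q]

theorem Q_zero (x : ℝ) : Q 0 x = 0 := by simp [Q]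

theorem Q_one (x : ℝ) : Q 1 x = 0 := by simp [Q]

theorem Q_succ_sub (n : ℕ) (x : ℝ) : Q (n + 1) x - Q n x = ∑ j ∈ Finset.range n, x ^ j := by
  rw [Q_eq_sum_range n, Q, Nat.add_sub_cancel, ← Finset.sum_sub_distrib]
  refine Finset.sum_congr rfl fun j _ => ?_
  push_cast; ring

/-- This is the reason for the choice of Q_n: it inverts the second difference on x^n with zero
initial data. -/
theorem Q_second_diff (n : ℕ) (x : ℝ) : Q (n + 2) x - 2 * Q (n + 1) x + Q n x = x ^ n := by
  have h1 := Q_succ_sub (n + 1) x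
  have h2 := Q_succ_sub n x
  rw [Finset.sum_range_succ] at h1
  linarith

theorem continuous_Q (n : ℕ) : Continuous (Q n) := by
  unfold Q; fun_prop

theorem Q_nonneg (n : ℕ) {x : ℝ} (hx : 0 ≤ x) : 0 ≤ Q n x := by
  refine Finset.sum_nonneg fun j hj => mul_nonneg ?_ (pow_nonneg hx j)
  have : j + 1 ≤ n := by have := Finset.mem_range.1 hj; omega
  have : (j : ℝ) + 1 ≤ n := by exact_mod_cast this
  linarith

theorem eq_of_second_diff_eq {a a' : ℕ → ℝ} (h0 : a 0 = a' 0) (h1 : a 1 = a' 1)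
    (h : ∀ n, a (n + 2) - 2 * a (n + 1) + a n = a' (n + 2) - 2 * a' (n + 1) + a' n) (n : ℕ) :
    a n = a' n := by
  have : a n = a' n ∧ a (n + 1) = a' (n + 1) := by
    induction n with
    | zero => exact ⟨h0, h1⟩
    | succ n ih => exact ⟨ih.2, by linarith [h n, ih.1, ih.2]⟩
  exact this.1

variable {γ : ℕ → ℝ} {b c : ℝ} {ν : Measure ℝ≥0}

theorem integrable_Q [IsFiniteMeasure ν] (hν : ∃ K : Set ℝ≥0, IsCompact K ∧ ν Kᶜ = 0) (n : ℕ) :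
    Integrable (fun x : ℝ≥0 => Q n x) ν := by
  obtain ⟨K, hK, h⟩ := hν
  exact integrable_of_compactSupport hK h ((continuous_Q n).comp NNReal.continuous_coe)

theorem integral_Q_second_diff [IsFiniteMeasure ν] (hν : ∃ K : Set ℝ≥0, IsCompact K ∧ ν Kᶜ = 0)
    (n : ℕ) :
    ∫ x : ℝ≥0, Q (n + 2) x ∂ν - 2 * ∫ x : ℝ≥0, Q (n + 1) x ∂ν + ∫ x : ℝ≥0, Q n x ∂ν
      = ∫ x, (x : ℝ) ^ n ∂ν := by
  rw [← integral_const_mul, ← integral_sub (integrable_Q hν _) ((integrable_Q hν _).const_mul _)]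
  refine (integral_add ((integrable_Q hν _).sub ((integrable_Q hν _).const_mul _))
    (integrable_Q hν _)).symm.trans ?_
  exact integral_congr_ae (ae_of_all _ fun x => Q_second_diff n x)

theorem formula_of_second_diff [IsFiniteMeasure ν]
    (hν : ∃ K : Set ℝ≥0, IsCompact K ∧ ν Kᶜ = 0)
    (h : ∀ n, γ (n + 2) - 2 * γ (n + 1) + γ n = 2 * c + ∫ x, (x : ℝ) ^ n ∂ν) (n : ℕ) :
    γ n = γ 0 + (γ 1 - γ 0 - c) * n + c * (n : ℝ) ^ 2 + ∫ x, Q n (x : ℝ) ∂ν := by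
  refine eq_of_second_diff_eq (a' := fun n : ℕ =>
    γ 0 + (γ 1 - γ 0 - c) * n + c * (n : ℝ) ^ 2 + ∫ x, Q n (x : ℝ) ∂ν) ?_ ?_ (fun n => ?_) n
  · simp [Q_zero]
  · simp only [Q_one, integral_zero]; push_cast; ring
  · rw [h, ← integral_Q_second_diff hν]
    push_cast
    ring

theorem IsScalarTriplet.second_diff (h : IsScalarTriplet γ b c ν) (n : ℕ) :
    γ (n + 2) - 2 * γ (n + 1) + γ n = 2 * c + ∫ x, (x : ℝ) ^ n ∂ν := by
  have := h.finite
  rw [← integral_Q_second_diff h.compactSupport, h.formula (n + 2), h.formula (n + 1), h.formula n]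
  push_cast
  ring

theorem IsScalarTriplet.first_diff (h : IsScalarTriplet γ b c ν) : b = γ 1 - γ 0 - c := by
  have := h.formula 1
  simp only [Q_one, integral_zero] at this
  push_cast at this
  linarith

/-- The scalar representing triplet is unique. -/
theorem IsScalarTriplet.unique {b' c' : ℝ} {ν' : Measure ℝ≥0} (h : IsScalarTriplet γ b c ν)
    (h' : IsScalarTriplet γ b' c' ν') : b = b' ∧ c = c' ∧ ν = ν' := by
  have := h.finite
  have := h'.finite
  -- The measure ν + 2cδ₁ has the second differences of γ as moments, so it is determined by γ.
  -- Since ν({1}) = 0, its atom at 1 then isolates c.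
  have hcs : ∀ {ρ : Measure ℝ≥0} (a : ℝ≥0), (∃ K : Set ℝ≥0, IsCompact K ∧ ρ Kᶜ = 0) →
      ∃ K : Set ℝ≥0, IsCompact K ∧ (ρ + a • Measure.dirac (1 : ℝ≥0)) Kᶜ = 0 := by
    rintro ρ a ⟨K, hK, hρ⟩
    refine ⟨insert 1 K, hK.insert 1, ?_⟩
    have h1 : ρ (insert 1 K)ᶜ = 0 :=
      measure_mono_null (Set.compl_subset_compl.2 (Set.subset_insert _ _)) hρ
    simp [h1]
  have hmom : ∀ {b c : ℝ} {ρ : Measure ℝ≥0} (ht : IsScalarTriplet γ b c ρ) (k : ℕ),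
      ∫ x, (x : ℝ) ^ k ∂(ρ + (2 * c).toNNReal • Measure.dirac (1 : ℝ≥0))
        = γ (k + 2) - 2 * γ (k + 1) + γ k := by
    intro b c ρ ht k
    have := ht.finite
    obtain ⟨K, hK, hρ⟩ := ht.compactSupport
    rw [integral_add_measure (integrable_of_compactSupport hK hρ (by fun_prop)),
      integral_smul_nnreal_measure, integral_dirac, ht.second_diff, NNReal.smul_def,
      Real.coe_toNNReal _ (by linarith [ht.nonneg])]
    · simp [add_comm]
    · exact (integrable_dirac (by simp)).smul_measure_nnreal
  have heq := measure_eq_of_moments (hcs (2 * c).toNNReal h.compactSupport)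
    (hcs (2 * c').toNNReal h'.compactSupport) fun k => by rw [hmom h, hmom h']
  have hc : c = c' := by
    have h1 := congrArg (fun ρ : Measure ℝ≥0 => ρ {1}) heq
    simp only [Measure.add_apply, h.singleton_one, h'.singleton_one, Measure.smul_apply, zero_add,
      Measure.dirac_apply_of_mem (Set.mem_singleton _)] at h1
    have h2 : (2 * c).toNNReal = (2 * c').toNNReal := by
      simpa [ENNReal.smul_def] using h1
    have := (Real.toNNReal_eq_toNNReal_iff (by linarith [h.nonneg]) (by linarith [h'.nonneg])).1 h2
    linarith
  refine ⟨by rw [h.first_diff, h'.first_diff, hc], hc, ?_⟩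
  subst hc
  ext s hs
  have h1 := congrArg (fun ρ : Measure ℝ≥0 => ρ s) heq
  simp only [Measure.add_apply] at h1
  exact (ENNReal.add_left_inj (measure_ne_top _ _)).1 h1

/-- The linear functional on polynomials with moments `γ`. -/
def momentFunctional (γ : ℕ → ℝ) : ℝ[X] →ₗ[ℝ] ℝ := (basisMonomials ℝ).constr ℝ γ

theorem momentFunctional_X_pow (γ : ℕ → ℝ) (n : ℕ) : momentFunctional γ (X ^ n) = γ n := by
  have := (basisMonomials ℝ).constr_basis ℝ γ n
  rw [coe_basisMonomials] at this
  rwa [← monomial_one_right_eq_X_pow]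

theorem momentFunctional_mul_mul (γ : ℕ → ℝ) (k : ℕ) (q : ℝ[X]) :
    momentFunctional γ (X ^ k * q * q) = ∑ i ∈ Finset.range (q.natDegree + 1),
      ∑ j ∈ Finset.range (q.natDegree + 1), γ (i + j + k) * q.coeff i * q.coeff j := by
  have : X ^ k * q * q = ∑ i ∈ Finset.range (q.natDegree + 1),
      ∑ j ∈ Finset.range (q.natDegree + 1),
        (q.coeff i * q.coeff j) • (X : ℝ[X]) ^ (i + j + k) := by
    conv_lhs => rw [mul_assoc, q.as_sum_range_C_mul_X_pow]
    rw [Finset.sum_mul_sum, Finset.mul_sum]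
    refine Finset.sum_congr rfl fun i _ => ?_
    rw [Finset.mul_sum]
    refine Finset.sum_congr rfl fun j _ => ?_
    rw [smul_eq_C_mul, C_mul]
    ring
  rw [this, map_sum]
  refine Finset.sum_congr rfl fun i _ => ?_
  rw [map_sum]
  refine Finset.sum_congr rfl fun j _ => ?_
  rw [map_smul, momentFunctional_X_pow, smul_eq_mul]
  ring

/-- The coefficients of q sum to q(1) = 0, so they are admissible in the CPD condition. -/
theorem momentFunctional_nonneg_of_isCPDSeq {k : ℕ} (h : IsCPDSeq fun n => γ (n + k)) {q : ℝ[X]}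
    (hq : q.eval 1 = 0) : 0 ≤ momentFunctional γ (X ^ k * q * q) := by
  have hz : ∑ j ∈ Finset.range (q.natDegree + 1), ((q.coeff j : ℝ) : ℂ) = 0 := by
    rw [eval_eq_sum_range] at hq
    simp only [one_pow, mul_one] at hq
    exact_mod_cast hq
  have := h q.natDegree (fun j => ((q.coeff j : ℝ) : ℂ)) hz
  simp only [Complex.conj_ofReal] at this
  rw [momentFunctional_mul_mul]
  exact_mod_cast this

/-- An exponentially bounded sequence all of whose shifts are conditionally positive definite has
a scalar representing triplet. -/
theorem exists_isScalarTriplet {M R : ℝ} (hR : 0 < R) (hM : ∀ n, |γ n| ≤ M * R ^ n)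
    (hγ : ∀ k, IsCPDSeq fun n => γ (n + k)) :
    ∃ (b c : ℝ) (ν : Measure ℝ≥0), IsScalarTriplet γ b c ν := by
  -- The factor (X - 1)² is shared between two equal factors that each vanish at 1, as the CPD
  -- condition requires.
  let L : ℝ[X] →ₗ[ℝ] ℝ := momentFunctional γ ∘ₗ LinearMap.mulRight ℝ ((X - 1) ^ 2 : ℝ[X])
  have hLX : ∀ n, L (X ^ n) = γ (n + 2) - 2 * γ (n + 1) + γ n := by
    intro n
    have : (X : ℝ[X]) ^ n * (X - 1) ^ 2 = X ^ (n + 2) - (2 : ℝ) • X ^ (n + 1) + X ^ n := by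
      rw [smul_eq_C_mul]; simp only [map_ofNat]; ring
    simp only [L, LinearMap.comp_apply, LinearMap.mulRight_apply, this, map_add, map_sub, map_smul,
      momentFunctional_X_pow, smul_eq_mul]
  obtain ⟨μ, hμ, hK, hmom⟩ := exists_measure_of_growth L (M := M * (R ^ 2 + 2 * R + 1)) hR
    (fun n => by
      rw [hLX]
      have h0 := abs_le.1 (hM n)
      have h1 := abs_le.1 (hM (n + 1))
      have h2 := abs_le.1 (hM (n + 2))
      have : M * (R ^ 2 + 2 * R + 1) * R ^ n
          = M * R ^ (n + 2) + 2 * (M * R ^ (n + 1)) + M * R ^ n := by ring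
      rw [this, abs_le]
      constructor <;> linarith)
    (fun k m => by
      have : (X : ℝ[X]) ^ k * (C R - X) ^ (2 * m) * (X - 1) ^ 2
          = X ^ k * ((C R - X) ^ m * (X - 1)) * ((C R - X) ^ m * (X - 1)) := by ring
      simp only [L, LinearMap.comp_apply, LinearMap.mulRight_apply, this]
      exact momentFunctional_nonneg_of_isCPDSeq (hγ k) (by simp))
  have hcs : ∃ K : Set ℝ≥0, IsCompact K ∧ μ.restrict {1}ᶜ Kᶜ = 0 := by
    obtain ⟨K, hK, h⟩ := hK
    exact ⟨K, hK, le_antisymm ((Measure.restrict_apply_le _ _).trans h.le) zero_le⟩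
  -- The atom of μ at 1 contributes the same mass to every moment, just as c n² has constant second
  -- difference 2c.
  have hsd : ∀ n, γ (n + 2) - 2 * γ (n + 1) + γ n
      = 2 * (μ.real {1} / 2) + ∫ x, (x : ℝ) ^ n ∂(μ.restrict {1}ᶜ) := by
    intro n
    obtain ⟨K, hK, h⟩ := hK
    rw [← hLX, ← hmom, ← integral_add_compl (measurableSet_singleton (1 : ℝ≥0))
      (integrable_of_compactSupport hK h (by fun_prop)), integral_singleton]
    simp only [NNReal.coe_one, one_pow, smul_eq_mul]
    ring
  exact ⟨_, μ.real {1} / 2, μ.restrict {1}ᶜ, by positivity, inferInstance, hcs, by simp,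
    formula_of_second_diff hcs hsd⟩

theorem IsScalarTriplet.le_apply (h : IsScalarTriplet γ b c ν) (n : ℕ) :
    γ 0 + b * n + c * (n : ℝ) ^ 2 ≤ γ n := by
  have : 0 ≤ ∫ x, Q n (x : ℝ) ∂ν := integral_nonneg fun x => Q_nonneg n x.2
  rw [h.formula n]
  linarith

end Scalar

end CPDShift

namespace CPDShift

open Filter Topology ContinuousLinearMap

/-! ### Uniqueness of operator triplets by reduction to vectors. -/

section Uniqueness

variable {H : Type*} [NormedAddCommGroup H] [InnerProductSpace ℂ H]

theorem clm_eq_of_inner_self_eq {A A' : H →L[ℂ] H}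
    (h : ∀ x, inner ℂ x (A x) = inner ℂ x (A' x)) : A = A' := by
  have : (A : H →ₗ[ℂ] H) = A' := (ext_inner_map _ _).1 fun x => by
    have := congrArg (starRingEnd ℂ) (h x)
    rwa [inner_conj_symm, inner_conj_symm] at this
  exact ContinuousLinearMap.coe_injective this

theorem SemispectralMeasure.scalarMeasure_apply_eq_zero (F : SemispectralMeasure H)
    {Δ : {Δ : Set ℝ≥0 // MeasurableSet Δ}} (hΔ : F.toFun Δ = 0) (h : H) :
    F.scalarMeasure h Δ.1 = 0 := by
  have := F.isFiniteMeasure_scalarMeasure h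
  have h1 := F.inner_eq_scalarMeasure h Δ
  rw [hΔ, _root_.zero_apply, inner_zero_right] at h1
  have h2 : (F.scalarMeasure h).real Δ.1 = 0 := by exact_mod_cast h1.symm
  exact (measureReal_eq_zero_iff).1 h2

/-- The scalar measure is obtained by choice; this identifies it with any explicit candidate. -/
theorem SemispectralMeasure.scalarMeasure_eq (F : SemispectralMeasure H) (h : H)
    {μ : Measure ℝ≥0} [IsFiniteMeasure μ]
    (hμ : ∀ Δ, inner ℂ h (F.toFun Δ h) = ((μ.real Δ.1 : ℝ) : ℂ)) : F.scalarMeasure h = μ := by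
  have := F.isFiniteMeasure_scalarMeasure h
  ext s hs
  have h1 := (F.inner_eq_scalarMeasure h ⟨s, hs⟩).symm.trans (hμ ⟨s, hs⟩)
  have h2 : (F.scalarMeasure h).real s = μ.real s := by exact_mod_cast h1
  exact (measureReal_eq_measureReal_iff).1 h2

theorem SemispectralMeasure.ext_scalarMeasure {F F' : SemispectralMeasure H}
    (h : ∀ x, F.scalarMeasure x = F'.scalarMeasure x) : F = F' := by
  have : F.toFun = F'.toFun := by
    funext Δ
    exact clm_eq_of_inner_self_eq fun x => by
      rw [F.inner_eq_scalarMeasure, F'.inner_eq_scalarMeasure, h]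
  cases F; cases F'; simpa using this

variable [CompleteSpace H] {T B C : H →L[ℂ] H} {F : SemispectralMeasure H}

theorem inner_adjoint_pow_mul_pow (T : H →L[ℂ] H) (n : ℕ) (h : H) :
    inner ℂ h ((adjoint T ^ n * T ^ n) h) = ((‖(T ^ n) h‖ ^ 2 : ℝ) : ℂ) := by
  have : adjoint T ^ n = adjoint (T ^ n) := by
    rw [← star_eq_adjoint, ← star_eq_adjoint, star_pow]
  rw [this, mul_apply_eq_comp, adjoint_inner_right, inner_self_eq_norm_sq_to_K]
  simp

theorem inner_eq_re_of_isSelfAdjoint {A : H →L[ℂ] H} (hA : IsSelfAdjoint A) (h : H) :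
    inner ℂ h (A h) = (((inner ℂ h (A h)).re : ℝ) : ℂ) := by
  refine (Complex.conj_eq_iff_re.1 ?_).symm
  rw [inner_conj_symm]
  exact isSelfAdjoint_iff_isSymmetric.1 hA h h

/-- Each vector turns a representing triplet of an operator into a scalar triplet. -/
theorem IsRepresentingTriplet.isScalarTriplet (ht : IsRepresentingTriplet T B C F) (h : H) :
    IsScalarTriplet (fun n => ‖(T ^ n) h‖ ^ 2) (inner ℂ h (B h)).re (inner ℂ h (C h)).re
      (F.scalarMeasure h) where
  nonneg := by
    have := ht.isPositive.inner_nonneg_right h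
    exact (Complex.le_def.1 this).1
  finite := F.isFiniteMeasure_scalarMeasure h
  compactSupport := by
    obtain ⟨K, hK, hF⟩ := ht.compactSupport
    exact ⟨K, hK, F.scalarMeasure_apply_eq_zero hF h⟩
  singleton_one := F.scalarMeasure_apply_eq_zero ht.singleton_one h
  formula n := by
    obtain ⟨A, hA, hT⟩ := ht.formula n
    have h1 := inner_adjoint_pow_mul_pow T n h
    have h0 := inner_adjoint_pow_mul_pow T 0 h
    rw [hT] at h1
    simp only [_root_.add_apply, _root_.smul_apply, inner_add_right,
      inner_smul_right, one_apply_eq_self, (hA h).2] at h1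
    rw [pow_zero, pow_zero, one_mul, one_apply_eq_self] at h0
    rw [h0, inner_eq_re_of_isSelfAdjoint ht.isSelfAdjoint,
      inner_eq_re_of_isSelfAdjoint ht.isPositive.isSelfAdjoint] at h1
    have h2 : ‖h‖ ^ 2 + n * (inner ℂ h (B h)).re + (n : ℝ) ^ 2 * (inner ℂ h (C h)).re
        + ∫ x, Q n (x : ℝ) ∂(F.scalarMeasure h) = ‖(T ^ n) h‖ ^ 2 := by exact_mod_cast h1
    rw [pow_zero, one_apply_eq_self, ← h2]
    ring

theorem IsRepresentingTriplet.unique {B' C' : H →L[ℂ] H} {F' : SemispectralMeasure H}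
    (h : IsRepresentingTriplet T B C F) (h' : IsRepresentingTriplet T B' C' F') :
    B = B' ∧ C = C' ∧ F = F' := by
  have hu := fun x => (h.isScalarTriplet x).unique (h'.isScalarTriplet x)
  refine ⟨clm_eq_of_inner_self_eq fun x => ?_, clm_eq_of_inner_self_eq fun x => ?_,
    SemispectralMeasure.ext_scalarMeasure fun x => (hu x).2.2⟩
  · rw [inner_eq_re_of_isSelfAdjoint h.isSelfAdjoint,
      inner_eq_re_of_isSelfAdjoint h'.isSelfAdjoint, (hu x).1]
  · rw [inner_eq_re_of_isSelfAdjoint h.isPositive.isSelfAdjoint,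
      inner_eq_re_of_isSelfAdjoint h'.isPositive.isSelfAdjoint, (hu x).2.1]

end Uniqueness

/-! ### Diagonal operators on ℓ². -/

section Diagonal

theorem e_apply_self (k : ℕ) : e k k = 1 := by simp [e]

theorem e_apply_ne {k j : ℕ} (h : j ≠ k) : e k j = 0 := by simp [e, h]

theorem inner_e_left (k : ℕ) (f : Ell2) : inner ℂ (e k) f = f k := by
  rw [e, lp.inner_single_left]; simp

theorem hasSum_smul_e (f : Ell2) : HasSum (fun k => f k • e k) f := by
  have h : (fun k => lp.single (E := fun _ : ℕ => ℂ) 2 k (f k)) = fun k => f k • e k := by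
    funext k
    rw [e, ← lp.single_smul, smul_eq_mul, mul_one]
  rw [← h]
  exact lp.hasSum_single (by norm_num) f

theorem clm_ext_e {G : Type*} [AddCommMonoid G] [Module ℂ G] [TopologicalSpace G] [T2Space G]
    {A A' : Ell2 →L[ℂ] G} (h : ∀ k, A (e k) = A' (e k)) : A = A' := by
  ext f
  have h1 := (hasSum_smul_e f).mapL A
  have h2 := (hasSum_smul_e f).mapL A'
  simp only [map_smul, h] at h1 h2
  exact h1.unique h2

theorem IsDiagonal.apply {A : Ell2 →L[ℂ] Ell2} {ξ : ℕ → ℂ} (hA : IsDiagonal A e ξ) (f : Ell2)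
    (k : ℕ) : A f k = ξ k * f k := by
  have : innerSL ℂ (e k) ∘L A = ξ k • innerSL ℂ (e k) := clm_ext_e fun j => by
    simp only [ContinuousLinearMap.comp_apply, hA j, _root_.smul_apply,
      innerSL_apply_apply, inner_smul_right, inner_e_left, smul_eq_mul]
    by_cases hj : k = j
    · rw [hj]
    · simp [e_apply_ne hj]
  have := congrArg (fun φ : Ell2 →L[ℂ] ℂ => φ f) this
  simpa only [ContinuousLinearMap.comp_apply, _root_.smul_apply,
      innerSL_apply_apply, inner_e_left, smul_eq_mul] using this

theorem IsDiagonal.hasSum_inner {A : Ell2 →L[ℂ] Ell2} {ξ : ℕ → ℝ}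
    (hA : IsDiagonal A e fun k => (ξ k : ℂ)) (f : Ell2) :
    HasSum (fun k => ((‖f k‖ ^ 2 * ξ k : ℝ) : ℂ)) (inner ℂ f (A f)) := by
  have h : (fun k => inner ℂ (f k) (A f k)) = fun k => ((‖f k‖ ^ 2 * ξ k : ℝ) : ℂ) := by
    funext k
    rw [hA.apply, ← smul_eq_mul, inner_smul_right, inner_self_eq_norm_sq_to_K]
    push_cast
    simp [mul_comm]
  rw [← h]
  exact lp.hasSum_inner f (A f)

theorem IsDiagonal.isSelfAdjoint {A : Ell2 →L[ℂ] Ell2} {ξ : ℕ → ℝ}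
    (hA : IsDiagonal A e fun k => (ξ k : ℂ)) : IsSelfAdjoint A := by
  rw [isSelfAdjoint_iff_isSymmetric]
  intro f g
  simp only [ContinuousLinearMap.coe_coe, lp.inner_eq_tsum]
  refine tsum_congr fun k => ?_
  rw [hA.apply, hA.apply, ← smul_eq_mul, ← smul_eq_mul, inner_smul_left, inner_smul_right,
    Complex.conj_ofReal]

theorem IsDiagonal.isPositive {A : Ell2 →L[ℂ] Ell2} {ξ : ℕ → ℝ}
    (hA : IsDiagonal A e fun k => (ξ k : ℂ)) (hξ : ∀ k, 0 ≤ ξ k) : A.IsPositive := by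
  have hs := isSelfAdjoint_iff_isSymmetric.1 hA.isSelfAdjoint
  refine (isPositive_iff A).2 ⟨hs, fun f => ?_⟩
  rw [show inner ℂ (A f) f = inner ℂ f (A f) from hs f f, ← (hA.hasSum_inner f).tsum_eq]
  exact tsum_nonneg fun k => by
    rw [Complex.zero_le_real]
    exact mul_nonneg (by positivity) (hξ k)

theorem hasSum_norm_sq (f : Ell2) : HasSum (fun k => ‖f k‖ ^ 2) (‖f‖ ^ 2) := by
  simpa using lp.hasSum_norm (p := 2) (by norm_num) f

theorem IsDiagonal.norm_le {A : Ell2 →L[ℂ] Ell2} {ξ : ℕ → ℂ} (hA : IsDiagonal A e ξ) {D : ℝ}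
    (hD : 0 ≤ D) (hξ : ∀ k, ‖ξ k‖ ≤ D) : ‖A‖ ≤ D := by
  refine opNorm_le_bound _ hD fun f => ?_
  have h : ‖A f‖ ^ 2 ≤ (D * ‖f‖) ^ 2 := by
    rw [mul_pow]
    refine hasSum_le (fun k => ?_) (hasSum_norm_sq (A f)) ((hasSum_norm_sq f).mul_left (D ^ 2))
    rw [hA.apply, norm_mul, mul_pow]
    exact mul_le_mul_of_nonneg_right (pow_le_pow_left₀ (norm_nonneg _) (hξ k) 2) (by positivity)
  exact (pow_le_pow_iff_left₀ (norm_nonneg _) (by positivity) two_ne_zero).1 h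

/-- A diagonal operator whose diagonal tends to zero is compact. -/
theorem IsDiagonal.isCompactOperator {A : Ell2 →L[ℂ] Ell2} {ξ : ℕ → ℂ} (hA : IsDiagonal A e ξ)
    (hξ : Tendsto ξ atTop (𝓝 0)) : IsCompactOperator A := by
  -- Finite-rank truncations; the error is diagonal, with norm controlled by the tail of ξ.
  let R : ℕ → Ell2 →L[ℂ] Ell2 := fun N =>
    ∑ k ∈ Finset.range N, (innerSL ℂ (e k)).smulRight (ξ k • e k)
  have hR : ∀ N, IsCompactOperator (R N) := by
    intro N
    induction N with
    | zero => simpa [R] using isCompactOperator_zero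
    | succ N ih =>
      have h1 : IsCompactOperator ((innerSL ℂ (e N)).smulRight (ξ N • e N)) :=
        IsCompactOperator.continuous_comp (M₂ := ℂ)
          (isCompactOperator_of_locallyCompactSpace_dom (innerSL ℂ (e N)))
          (g := fun z : ℂ => z • (ξ N • e N)) (by fun_prop)
      have h2 : R (N + 1) = R N + (innerSL ℂ (e N)).smulRight (ξ N • e N) :=
        Finset.sum_range_succ _ _
      rw [h2]
      exact ih.add h1
  have hdiag : ∀ N, IsDiagonal (A - R N) e fun k => if k < N then 0 else ξ k := by
    intro N j
    have h1 : R N (e j) = if j < N then ξ j • e j else 0 := by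
      simp only [R, _root_.sum_apply, ContinuousLinearMap.smulRight_apply,
        innerSL_apply_apply, inner_e_left]
      split_ifs with hj
      · rw [Finset.sum_eq_single_of_mem j (Finset.mem_range.2 hj), e_apply_self, one_smul]
        intro k _ hk
        rw [e_apply_ne hk, zero_smul]
      · refine Finset.sum_eq_zero fun k hk => ?_
        rw [e_apply_ne (by have := Finset.mem_range.1 hk; omega), zero_smul]
    rw [_root_.sub_apply, h1, hA j]
    by_cases hj : j < N <;> simp [hj]
  refine isCompactOperator_of_tendsto (F := R) (l := atTop) ?_ (Eventually.of_forall hR)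
  rw [Metric.tendsto_atTop]
  intro ε hε
  obtain ⟨N, hN⟩ := (Metric.tendsto_atTop.1 hξ) (ε / 2) (by positivity)
  refine ⟨N, fun n hn => ?_⟩
  rw [dist_comm, dist_eq_norm]
  refine lt_of_le_of_lt ((hdiag n).norm_le (D := ε / 2) (by positivity) fun k => ?_) (by linarith)
  split_ifs with hk
  · simp only [norm_zero]; positivity
  · have := hN k (by omega)
    rw [dist_zero_right] at this
    exact this.le

theorem adjoint_weightedShift_apply (w : ℕ → ℝ) (hw : Bornology.IsBounded (Set.range w))
    (f : Ell2) (k : ℕ) : adjoint (weightedShift w hw) f k = (w k : ℂ) * f (k + 1) := by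
  rw [← inner_e_left, adjoint_inner_right, weightedShift_e, inner_smul_left, inner_e_left,
    Complex.conj_ofReal]

theorem adjoint_weightedShift_e (w : ℕ → ℝ) (hw : Bornology.IsBounded (Set.range w)) (n : ℕ) :
    adjoint (weightedShift w hw) (e (n + 1)) = (w n : ℂ) • e n := by
  ext k
  rw [adjoint_weightedShift_apply]
  change _ = (w n : ℂ) * e n k
  by_cases hk : k = n
  · subst hk; simp [e_apply_self]
  · have : k + 1 ≠ n + 1 := by omega
    simp [e_apply_ne hk, e_apply_ne this]

/-- Every bounded real sequence is the diagonal of a bounded operator. -/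
theorem exists_isDiagonal {ξ : ℕ → ℝ} {D : ℝ} (hξ : ∀ k, |ξ k| ≤ D) :
    ∃ A : Ell2 →L[ℂ] Ell2, IsDiagonal A e fun k => (ξ k : ℂ) := by
  have hbd : ∀ {u : ℕ → ℝ} {D : ℝ}, (∀ k, |u k| ≤ D) → Bornology.IsBounded (Set.range u) := by
    intro u D hu
    refine isBounded_iff_forall_norm_le.2 ⟨D, ?_⟩
    rintro _ ⟨k, rfl⟩
    exact hu k
  have h1 : Bornology.IsBounded (Set.range fun _ : ℕ => (1 : ℝ)) := hbd (D := 1) (by simp)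
  -- Shift forward with weights ξ, then back with weights 1: e_k ↦ ξ_k e_{k+1} ↦ ξ_k e_k.
  refine ⟨adjoint (weightedShift _ h1) ∘L weightedShift ξ (hbd hξ), fun k => ?_⟩
  rw [ContinuousLinearMap.comp_apply, weightedShift_e, map_smul, adjoint_weightedShift_e]
  simp

end Diagonal

/-! ### Powers of the shift and existence of the scalar triplet. -/

section Shift

variable {w : ℕ → ℝ} (hw : Bornology.IsBounded (Set.range w))

theorem weightedShift_pow_e (n k : ℕ) : (weightedShift w hw ^ n) (e k)
    = ((∏ i ∈ Finset.range n, w (k + i) : ℝ) : ℂ) • e (k + n) := by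
  induction n with
  | zero => simp
  | succ n ih =>
    rw [pow_succ', mul_apply_eq_comp, ih, map_smul, weightedShift_e, smul_smul,
      Finset.prod_range_succ, add_assoc]
    push_cast
    rfl

theorem adjoint_weightedShift_pow_e (n k : ℕ) : (adjoint (weightedShift w hw) ^ n) (e (k + n))
    = ((∏ i ∈ Finset.range n, w (k + i) : ℝ) : ℂ) • e k := by
  induction n with
  | zero => simp
  | succ n ih =>
    rw [pow_succ, mul_apply_eq_comp, ← add_assoc, adjoint_weightedShift_e, map_smul,
      ih, smul_smul, Finset.prod_range_succ]
    push_cast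
    rw [mul_comm]

theorem hat_pos (hpos : ∀ n, 0 < w n) (n : ℕ) : 0 < hat w n :=
  Finset.prod_pos fun i _ => pow_pos (hpos i) 2

theorem hat_add (k n : ℕ) :
    hat w (k + n) = hat w k * (∏ i ∈ Finset.range n, w (k + i)) ^ 2 := by
  rw [hat, Finset.prod_range_add, ← Finset.prod_pow, hat]

theorem hat_add_div (hpos : ∀ n, 0 < w n) (k n : ℕ) :
    hat w (k + n) / hat w k = (∏ i ∈ Finset.range n, w (k + i)) ^ 2 := by
  rw [hat_add, mul_div_cancel_left₀ _ (hat_pos hpos k).ne']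

theorem isDiagonal_adjoint_pow_mul_pow (hpos : ∀ n, 0 < w n) (n : ℕ) :
    IsDiagonal (adjoint (weightedShift w hw) ^ n * weightedShift w hw ^ n) e
      fun k => ((hat w (k + n) / hat w k : ℝ) : ℂ) := by
  intro k
  rw [mul_apply_eq_comp, weightedShift_pow_e, map_smul, adjoint_weightedShift_pow_e,
    smul_smul]
  simp only [hat_add_div hpos, sq]
  push_cast
  rfl

theorem norm_weightedShift_pow_e_sq (hpos : ∀ n, 0 < w n) (n k : ℕ) :
    ‖(weightedShift w hw ^ n) (e k)‖ ^ 2 = hat w (k + n) / hat w k := by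
  have h := inner_adjoint_pow_mul_pow (weightedShift w hw) n (e k)
  rw [isDiagonal_adjoint_pow_mul_pow hw hpos n k, inner_smul_right, inner_e_left, e_apply_self,
    mul_one] at h
  beta_reduce at h
  exact_mod_cast h.symm

theorem exists_hat_add_le {w : ℕ → ℝ} (hw : Bornology.IsBounded (Set.range w)) (hpos : ∀ n, 0 < w n) :
    ∃ R : ℝ, 0 < R ∧ ∀ k n, hat w (k + n) / hat w k ≤ R ^ n := by
  obtain ⟨M, hM⟩ := exists_bound hw
  have hM0 : 0 < M := (abs_pos.2 (hpos 0).ne').trans_le (hM 0)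
  refine ⟨M ^ 2, by positivity, fun k n => ?_⟩
  rw [hat_add_div hpos, ← pow_mul, mul_comm 2 n, pow_mul]
  refine pow_le_pow_left₀ (Finset.prod_nonneg fun i _ => (hpos _).le) ?_ 2
  calc ∏ i ∈ Finset.range n, w (k + i) ≤ ∏ _i ∈ Finset.range n, M :=
        Finset.prod_le_prod (fun i _ => (hpos _).le) fun i _ => (le_abs_self _).trans (hM _)
    _ = M ^ n := by simp

theorem IsCPDSeq.const_mul {γ : ℕ → ℝ} (h : IsCPDSeq γ) {a : ℝ} (ha : 0 ≤ a) :
    IsCPDSeq fun n => a * γ n := by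
  intro k z hz
  have : ∑ i ∈ Finset.range (k + 1), ∑ j ∈ Finset.range (k + 1),
      ((a * γ (i + j) : ℝ) : ℂ) * z i * (starRingEnd ℂ) (z j)
      = (a : ℂ) * ∑ i ∈ Finset.range (k + 1), ∑ j ∈ Finset.range (k + 1),
        (γ (i + j) : ℂ) * z i * (starRingEnd ℂ) (z j) := by
    simp only [Finset.mul_sum]
    refine Finset.sum_congr rfl fun i _ => Finset.sum_congr rfl fun j _ => ?_
    push_cast; ring
  rw [this]
  exact mul_nonneg (Complex.zero_le_real.2 ha) (h k z hz)

theorem exists_isScalarTriplet_hat (hpos : ∀ n, 0 < w n) (hCPD : IsCPD (weightedShift w hw)) :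
    ∃ (b c : ℝ) (ν : Measure ℝ≥0), IsScalarTriplet (hat w) b c ν := by
  obtain ⟨R, hR, hle⟩ := exists_hat_add_le hw hpos
  refine exists_isScalarTriplet (M := 1) hR (fun n => ?_) fun k => ?_
  · have := hle 0 n
    rw [abs_of_pos (hat_pos hpos n), one_mul]
    simpa [hat] using this
  · have h := (hCPD (e k)).const_mul (hat_pos hpos k).le
    have heq : (fun n => hat w (n + k))
        = fun n => hat w k * ‖(weightedShift w hw ^ n) (e k)‖ ^ 2 := by
      funext n
      rw [norm_weightedShift_pow_e_sq hw hpos, mul_div_cancel₀ _ (hat_pos hpos k).ne', add_comm]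
    rw [heq]
    exact h

end Shift

end CPDShift

namespace CPDShift

open Filter Topology ContinuousLinearMap

/-! ### Diagonal semispectral measures. -/

section Mixture

/-- The measure `∑ₖ aₖ xᵏ ν(dx)`. -/
def mixture (ν : Measure ℝ≥0) (a : ℕ → ℝ≥0) : Measure ℝ≥0 :=
  Measure.sum fun k => a k • ν.withDensity fun x => ((x ^ k : ℝ≥0) : ℝ≥0∞)

variable {ν : Measure ℝ≥0} [IsFiniteMeasure ν]

/-- Domination by D ∑ aₖ ∫ xᵏ dν allows integration term by term. It is applied to constants,
indicators and Q_n. -/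
theorem integrable_mixture_and_hasSum (hν : ∃ K : Set ℝ≥0, IsCompact K ∧ ν Kᶜ = 0) {a : ℕ → ℝ≥0}
    (ha : Summable fun k => (a k : ℝ) * ∫ x, (x : ℝ) ^ k ∂ν) {f : ℝ≥0 → ℝ} (hf : Measurable f)
    {D : ℝ} (hD : ∀ᵐ x ∂ν, ‖f x‖ ≤ D) :
    Integrable f (mixture ν a) ∧
      HasSum (fun k => (a k : ℝ) * ∫ x, (x : ℝ) ^ k * f x ∂ν) (∫ x, f x ∂(mixture ν a)) := by
  obtain ⟨K, hK, hνK⟩ := hν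
  have hpow : ∀ k : ℕ, Integrable (fun x : ℝ≥0 => (x : ℝ) ^ k) ν := fun k =>
    integrable_of_compactSupport hK hνK (by fun_prop)
  have hle : ∀ k : ℕ, ∀ᵐ x ∂ν, ‖((x : ℝ≥0) : ℝ) ^ k * f x‖ ≤ D * (x : ℝ) ^ k := fun k =>
    hD.mono fun x hx => by
      rw [norm_mul, Real.norm_of_nonneg (by positivity), mul_comm]
      exact mul_le_mul_of_nonneg_right hx (by positivity)
  have hxf : ∀ k : ℕ, Integrable (fun x : ℝ≥0 => (x : ℝ) ^ k * f x) ν := fun k =>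
    ((hpow k).const_mul D).mono' (by fun_prop) (hle k)
  have hm : ∀ k : ℕ, Measurable fun x : ℝ≥0 => x ^ k := fun k => by fun_prop
  have hint : ∀ k, Integrable f (a k • ν.withDensity fun x => ((x ^ k : ℝ≥0) : ℝ≥0∞)) := by
    intro k
    refine Integrable.smul_measure_nnreal ?_
    rw [integrable_withDensity_iff_integrable_smul (hm k)]
    simpa only [NNReal.smul_def, NNReal.coe_pow, smul_eq_mul] using hxf k
  have hval : ∀ (g : ℝ≥0 → ℝ) (k : ℕ),
      ∫ x, g x ∂(a k • ν.withDensity fun x => ((x ^ k : ℝ≥0) : ℝ≥0∞))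
        = (a k : ℝ) * ∫ x, (x : ℝ) ^ k * g x ∂ν := by
    intro g k
    rw [integral_smul_nnreal_measure, integral_withDensity_eq_integral_smul (hm k)]
    simp only [NNReal.smul_def, NNReal.coe_pow, smul_eq_mul]
  have hi : Integrable f (mixture ν a) := by
    refine integrable_sum_measure hint (Summable.of_nonneg_of_le
      (fun k => integral_nonneg fun x => norm_nonneg _) (fun k => ?_) (ha.mul_left D))
    rw [hval, mul_left_comm]
    refine mul_le_mul_of_nonneg_left ?_ (a k).2
    rw [← integral_const_mul]
    refine integral_mono_ae ?_ ((hpow k).const_mul D) ?_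
    · refine (hxf k).norm.congr (ae_of_all _ fun x => ?_)
      simp
    · refine (hle k).mono fun x hx => ?_
      simpa using hx
  refine ⟨hi, ?_⟩
  have hs := hasSum_integral_measure hi
  simp only [hval] at hs
  exact hs

/-- The diagonal semispectral measure whose `k`-th diagonal term is `x^k ν(dx) / d_k`. -/
theorem exists_diagonal_semispectralMeasure (hν : ∃ K : Set ℝ≥0, IsCompact K ∧ ν Kᶜ = 0)
    {d : ℕ → ℝ} (hd : ∀ k, 0 < d k) {D : ℝ} (hD : ∀ k, 1 / d k * ∫ x, (x : ℝ) ^ k ∂ν ≤ D) :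
    ∃ F : SemispectralMeasure Ell2,
      (∀ Δ, IsDiagonal (F.toFun Δ) e
        fun k => ((1 / d k * ∫ x in Δ.1, (x : ℝ) ^ k ∂ν : ℝ) : ℂ)) ∧
      ∀ (f : ℝ≥0 → ℝ) (M : ℝ), Measurable f → (∀ᵐ x ∂ν, ‖f x‖ ≤ M) → ∀ h : Ell2,
        Integrable f (F.scalarMeasure h) ∧
        HasSum (fun k => ‖h k‖ ^ 2 * (1 / d k * ∫ x, (x : ℝ) ^ k * f x ∂ν))
          (∫ x, f x ∂(F.scalarMeasure h)) := by
  have hpow : ∀ k : ℕ, Integrable (fun x : ℝ≥0 => (x : ℝ) ^ k) ν := fun k => by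
    obtain ⟨K, hK, hνK⟩ := hν
    exact integrable_of_compactSupport hK hνK (by fun_prop)
  have hex : ∀ Δ : {Δ : Set ℝ≥0 // MeasurableSet Δ}, ∃ A : Ell2 →L[ℂ] Ell2,
      IsDiagonal A e fun k => ((1 / d k * ∫ x in Δ.1, (x : ℝ) ^ k ∂ν : ℝ) : ℂ) := by
    intro Δ
    refine exists_isDiagonal (D := D) fun k => ?_
    have h0 : 0 ≤ ∫ x in Δ.1, (x : ℝ) ^ k ∂ν := integral_nonneg fun x => by positivity
    have h1 : ∫ x in Δ.1, (x : ℝ) ^ k ∂ν ≤ ∫ x, (x : ℝ) ^ k ∂ν :=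
      setIntegral_le_integral (hpow k) (ae_of_all _ fun x => by positivity)
    have h2 : 0 ≤ 1 / d k := (one_div_pos.2 (hd k)).le
    rw [abs_of_nonneg (mul_nonneg h2 h0)]
    exact (mul_le_mul_of_nonneg_left h1 h2).trans (hD k)
  choose A hA using hex
  -- A diagonal F forces ⟨F(·)h, h⟩ to be the sum of |h_k|² x^k ν(dx) / d_k, which dictates these
  -- weights.
  let a : Ell2 → ℕ → ℝ≥0 := fun h k => (‖h k‖ ^ 2 / d k).toNNReal
  have hcoe : ∀ h k, (a h k : ℝ) = ‖h k‖ ^ 2 / d k := fun h k =>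
    Real.coe_toNNReal _ (div_nonneg (by positivity) (hd k).le)
  have ha : ∀ h, Summable fun k => (a h k : ℝ) * ∫ x, (x : ℝ) ^ k ∂ν := by
    intro h
    refine Summable.of_nonneg_of_le (fun k => mul_nonneg (a h k).2
      (integral_nonneg fun x => by positivity)) (fun k => ?_) ((hasSum_norm_sq h).summable.mul_right D)
    rw [hcoe, div_eq_mul_one_div, mul_assoc]
    exact mul_le_mul_of_nonneg_left (hD k) (by positivity)
  have hmix : ∀ (f : ℝ≥0 → ℝ) (M : ℝ), Measurable f → (∀ᵐ x ∂ν, ‖f x‖ ≤ M) → ∀ h : Ell2,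
        Integrable f (mixture ν (a h)) ∧
        HasSum (fun k => ‖h k‖ ^ 2 * (1 / d k * ∫ x, (x : ℝ) ^ k * f x ∂ν))
          (∫ x, f x ∂(mixture ν (a h))) := by
    intro f M hf hM h
    have := integrable_mixture_and_hasSum hν (ha h) hf hM
    refine ⟨this.1, ?_⟩
    have h2 := this.2
    simp only [hcoe] at h2
    simpa only [div_eq_mul_one_div (‖h _‖ ^ 2), mul_assoc] using h2
  have hfin : ∀ h, IsFiniteMeasure (mixture ν (a h)) := fun h =>
    (integrable_const_iff_isFiniteMeasure one_ne_zero).1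
      (hmix (fun _ => 1) 1 measurable_const (by simp) h).1
  have hreal : ∀ (h : Ell2) (Δ : {Δ : Set ℝ≥0 // MeasurableSet Δ}),
      inner ℂ h (A Δ h) = (((mixture ν (a h)).real Δ.1 : ℝ) : ℂ) := by
    intro h Δ
    have h1 := (hmix (Δ.1.indicator fun _ => 1) 1 (measurable_const.indicator Δ.2)
      (ae_of_all _ fun x => (norm_indicator_le_norm_self _ _).trans (by simp)) h).2
    have h2 : ∀ k : ℕ, ∫ x, (x : ℝ) ^ k * Δ.1.indicator (fun _ => (1 : ℝ)) x ∂ν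
        = ∫ x in Δ.1, (x : ℝ) ^ k ∂ν := by
      intro k
      rw [← integral_indicator Δ.2]
      refine integral_congr_ae (ae_of_all _ fun x => ?_)
      by_cases hx : x ∈ Δ.1 <;> simp [hx]
    rw [integral_indicator_const _ Δ.2, smul_eq_mul, mul_one] at h1
    simp only [h2] at h1
    exact ((hA Δ).hasSum_inner h).unique (Complex.hasSum_ofReal.2 h1)
  let F : SemispectralMeasure Ell2 := ⟨A, fun h => ⟨mixture ν (a h), hfin h, hreal h⟩⟩
  refine ⟨F, hA, fun f M hf hM h => ?_⟩
  have := hfin h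
  rw [F.scalarMeasure_eq h (hreal h)]
  exact hmix f M hf hM h

end Mixture

/-! ### From the scalar triplet to the operator triplet. -/

section Construction

variable {w : ℕ → ℝ} {b c : ℝ} {ν : Measure ℝ≥0}

theorem IsScalarTriplet.tendsto_div_hat (h : IsScalarTriplet (hat w) b c ν) :
    Tendsto (fun k => c / hat w k) atTop (𝓝 0) := by
  rcases h.nonneg.eq_or_lt with hc | hc
  · simp [← hc]
  · refine Tendsto.const_div_atTop ?_ c
    have h1 : Tendsto (fun k : ℕ => (k : ℝ) * (b + c * k)) atTop atTop :=
      tendsto_natCast_atTop_atTop.atTop_mul_atTop₀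
        (tendsto_atTop_add_const_left _ _ (tendsto_natCast_atTop_atTop.const_mul_atTop hc))
    refine tendsto_atTop_mono (fun k => ?_) (tendsto_atTop_add_const_left _ (hat w 0) h1)
    have := h.le_apply k
    linarith

/-- The representing triplet of a weighted shift obtained from a scalar representing triplet. -/
theorem IsScalarTriplet.exists_isRepresentingTriplet (hw : Bornology.IsBounded (Set.range w))
    (hpos : ∀ n, 0 < w n) (h : IsScalarTriplet (hat w) b c ν) :
    ∃ (B C : Ell2 →L[ℂ] Ell2) (F : SemispectralMeasure Ell2),
      IsRepresentingTriplet (weightedShift w hw) B C F ∧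
      IsDiagonal B e (fun k => (((hat w (k + 1) - hat w k - c) / hat w k : ℝ) : ℂ)) ∧
      IsDiagonal C e (fun k => ((c / hat w k : ℝ) : ℂ)) ∧
      ∀ Δ, IsDiagonal (F.toFun Δ) e
        fun k => ((1 / hat w k * ∫ x in Δ.1, (x : ℝ) ^ k ∂ν : ℝ) : ℂ) := by
  have := h.finite
  have hh : ∀ k, 0 < hat w k := hat_pos hpos
  obtain ⟨R, hR, hle⟩ := exists_hat_add_le hw hpos
  obtain ⟨K, hK, hνK⟩ := h.compactSupport
  -- The left side is the second difference of `hat w` at k divided by `hat w k`. Both summands are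
  -- nonnegative, so this one bound controls C and F, and with the first ratio also B.
  have hsum : ∀ k, 2 * (c / hat w k) + 1 / hat w k * ∫ x, (x : ℝ) ^ k ∂ν ≤ R ^ 2 + 1 := by
    intro k
    have h1 : 2 * (c / hat w k) + 1 / hat w k * ∫ x, (x : ℝ) ^ k ∂ν
        = hat w (k + 2) / hat w k - 2 * (hat w (k + 1) / hat w k) + 1 := by
      have := hh k
      field_simp
      rw [← h.second_diff]
    rw [h1]
    have := hle k 2
    have : 0 ≤ hat w (k + 1) / hat w k := (div_pos (hh _) (hh _)).le
    linarith
  have hc0 : ∀ k, 0 ≤ c / hat w k := fun k => div_nonneg h.nonneg (hh k).le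
  have hm0 : ∀ k, 0 ≤ 1 / hat w k * ∫ x, (x : ℝ) ^ k ∂ν := fun k =>
    mul_nonneg (one_div_pos.2 (hh k)).le (integral_nonneg fun x => by positivity)
  obtain ⟨F, hF, hFint⟩ := exists_diagonal_semispectralMeasure h.compactSupport hh
    (D := R ^ 2 + 1) fun k => by linarith [hsum k, hc0 k]
  obtain ⟨C, hC⟩ := exists_isDiagonal (ξ := fun k => c / hat w k) (D := R ^ 2 + 1) fun k => by
    rw [abs_of_nonneg (hc0 k)]
    linarith [hsum k, hc0 k, hm0 k]
  obtain ⟨B, hB⟩ := exists_isDiagonal (ξ := fun k => (hat w (k + 1) - hat w k - c) / hat w k)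
    (D := R + 1 + (R ^ 2 + 1)) fun k => by
      have h1 : (hat w (k + 1) - hat w k - c) / hat w k
          = hat w (k + 1) / hat w k - 1 - c / hat w k := by
        rw [sub_div, sub_div, div_self (hh k).ne']
      have h2 := hle k 1
      have h3 : 0 ≤ hat w (k + 1) / hat w k := (div_pos (hh _) (hh _)).le
      rw [pow_one] at h2
      rw [h1, abs_le]
      constructor <;> linarith [hsum k, hc0 k, hm0 k]
  have hnull : ∀ Δ : {Δ : Set ℝ≥0 // MeasurableSet Δ}, ν Δ.1 = 0 → F.toFun Δ = 0 := by
    intro Δ hΔ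
    refine clm_ext_e fun k => ?_
    rw [hF Δ k, Measure.restrict_eq_zero.2 hΔ]
    simp
  refine ⟨B, C, F, ⟨hB.isSelfAdjoint, hC.isPositive hc0, ⟨K, hK, hnull _ hνK⟩,
    hnull _ h.singleton_one, fun n => ?_⟩, hB, hC, hF⟩
  -- The integral of Q_n is taken to be whatever the formula requires; what remains is to match its
  -- diagonal with the integrals of Q_n against ν_k.
  refine ⟨adjoint (weightedShift w hw) ^ n * weightedShift w hw ^ n
    - (1 + (n : ℂ) • B + ((n : ℂ) ^ 2) • C), fun f => ?_, by abel⟩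
  have hQc : Continuous fun x : ℝ≥0 => Q n x := (continuous_Q n).comp NNReal.continuous_coe
  obtain ⟨M, hM⟩ := hK.exists_bound_of_continuousOn hQc.continuousOn
  obtain ⟨hint, hsumQ⟩ := hFint (fun x => Q n x) M hQc.measurable
    ((show ∀ᵐ x ∂ν, x ∈ K from mem_ae_iff.2 hνK).mono hM) f
  refine ⟨hint, ?_⟩
  have hformula : ∀ k, hat w (k + n) / hat w k = 1 + n * ((hat w (k + 1) - hat w k - c) / hat w k)
      + (n : ℝ) ^ 2 * (c / hat w k) + 1 / hat w k * ∫ x, (x : ℝ) ^ k * Q n x ∂ν := by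
    intro k
    have hpowi : ∀ m : ℕ, Integrable (fun x : ℝ≥0 => (x : ℝ) ^ k * Q m x) ν := fun m =>
      integrable_of_compactSupport hK hνK
        ((by fun_prop : Continuous fun x : ℝ≥0 => (x : ℝ) ^ k).mul
          ((continuous_Q m).comp NNReal.continuous_coe))
    -- Second differences at k + m involve x^{k+m} = x^k x^m, so the sequence started at k has the
    -- same c and the measure x^k ν.
    have hadd : hat w (k + n) = hat w k + (hat w (k + 1) - hat w k - c) * n + c * (n : ℝ) ^ 2
        + ∫ x, (x : ℝ) ^ k * Q n x ∂ν := by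
      refine eq_of_second_diff_eq (a := fun n => hat w (k + n)) (a' := fun n : ℕ =>
        hat w k + (hat w (k + 1) - hat w k - c) * n + c * (n : ℝ) ^ 2
        + ∫ x, (x : ℝ) ^ k * Q n x ∂ν) ?_ ?_ (fun m => ?_) n
      · simp [Q_zero]
      · simp only [Q_one, mul_zero, integral_zero]; push_cast; ring
      · have h1 : ∫ x : ℝ≥0, (x : ℝ) ^ k * Q (m + 2) x ∂ν
            - 2 * ∫ x : ℝ≥0, (x : ℝ) ^ k * Q (m + 1) x ∂ν + ∫ x : ℝ≥0, (x : ℝ) ^ k * Q m x ∂ν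
            = ∫ x, (x : ℝ) ^ (k + m) ∂ν := by
          rw [← integral_const_mul, ← integral_sub (hpowi _) ((hpowi _).const_mul _)]
          refine (integral_add ((hpowi _).sub ((hpowi _).const_mul _)) (hpowi _)).symm.trans ?_
          refine integral_congr_ae (ae_of_all _ fun x => ?_)
          have := Q_second_diff m x
          simp only [Pi.sub_apply, pow_add, ← this]
          ring
        have h2 := h.second_diff (k + m)
        rw [← h1] at h2
        rw [← add_assoc, ← add_assoc, h2]
        push_cast
        ring
    rw [hadd]
    have := hh k
    field_simp
  have hdiag : IsDiagonal (adjoint (weightedShift w hw) ^ n * weightedShift w hw ^ n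
      - (1 + (n : ℂ) • B + ((n : ℂ) ^ 2) • C)) e
      fun k => ((1 / hat w k * ∫ x, (x : ℝ) ^ k * Q n x ∂ν : ℝ) : ℂ) := by
    intro k
    have h1 := isDiagonal_adjoint_pow_mul_pow hw hpos n k
    beta_reduce at h1
    rw [hformula] at h1
    rw [_root_.sub_apply, h1, _root_.add_apply, _root_.add_apply, _root_.smul_apply,
      _root_.smul_apply, one_apply_eq_self, hB k, hC k]
    push_cast
    module
  exact (hdiag.hasSum_inner f).unique (Complex.hasSum_ofReal.2 hsumQ)

end Construction

end CPDShift

end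

theorem mainTheorem5 (w : ℕ → ℝ) (hpos : ∀ n, 0 < w n)
    (hbdd : Bornology.IsBounded (Set.range w))
    (hCPD : CPDShift.IsCPD (CPDShift.weightedShift w hbdd)) :
    -- the scalar and the operator representing triplets of the shift are well defined
    (∃! t : ℝ × ℝ × Measure ℝ≥0,
      CPDShift.IsScalarTriplet (CPDShift.hat w) t.1 t.2.1 t.2.2) ∧
    (∃! t : (CPDShift.Ell2 →L[ℂ] CPDShift.Ell2) × (CPDShift.Ell2 →L[ℂ] CPDShift.Ell2) ×
        CPDShift.SemispectralMeasure CPDShift.Ell2,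
      CPDShift.IsRepresentingTriplet (CPDShift.weightedShift w hbdd) t.1 t.2.1 t.2.2) ∧
    -- and they are related as follows
    ∀ (b c : ℝ) (ν : Measure ℝ≥0) (B C : CPDShift.Ell2 →L[ℂ] CPDShift.Ell2)
      (F : CPDShift.SemispectralMeasure CPDShift.Ell2),
      CPDShift.IsScalarTriplet (CPDShift.hat w) b c ν →
      CPDShift.IsRepresentingTriplet (CPDShift.weightedShift w hbdd) B C F →
      CPDShift.IsDiagonal B CPDShift.e (fun k =>
        (((CPDShift.hat w (k + 1) - CPDShift.hat w k - c) / CPDShift.hat w k : ℝ) : ℂ)) ∧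
      CPDShift.IsDiagonal C CPDShift.e (fun k => ((c / CPDShift.hat w k : ℝ) : ℂ)) ∧
      (∀ Δ : {Δ : Set ℝ≥0 // MeasurableSet Δ},
        CPDShift.IsDiagonal (F.toFun Δ) CPDShift.e (fun k =>
          (((1 / CPDShift.hat w k) * ∫ x in Δ.1, (x : ℝ) ^ k ∂ν : ℝ) : ℂ))) ∧
      IsCompactOperator C := by
  have huniq : ∀ {b c : ℝ} {ν : Measure ℝ≥0} {B C : CPDShift.Ell2 →L[ℂ] CPDShift.Ell2}
      {F : CPDShift.SemispectralMeasure CPDShift.Ell2},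
      CPDShift.IsScalarTriplet (CPDShift.hat w) b c ν →
      CPDShift.IsRepresentingTriplet (CPDShift.weightedShift w hbdd) B C F →
      CPDShift.IsDiagonal B CPDShift.e (fun k =>
        (((CPDShift.hat w (k + 1) - CPDShift.hat w k - c) / CPDShift.hat w k : ℝ) : ℂ)) ∧
      CPDShift.IsDiagonal C CPDShift.e (fun k => ((c / CPDShift.hat w k : ℝ) : ℂ)) ∧
      ∀ Δ, CPDShift.IsDiagonal (F.toFun Δ) CPDShift.e (fun k =>
        (((1 / CPDShift.hat w k) * ∫ x in Δ.1, (x : ℝ) ^ k ∂ν : ℝ) : ℂ)) := by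
    intro b c ν B C F hs ht
    obtain ⟨B', C', F', ht', hB, hC, hF⟩ := hs.exists_isRepresentingTriplet hbdd hpos
    -- Uniqueness transfers the diagonal form of the constructed triplet to the given one.
    obtain ⟨rfl, rfl, rfl⟩ := ht.unique ht'
    exact ⟨hB, hC, hF⟩
  obtain ⟨b, c, ν, hs⟩ := CPDShift.exists_isScalarTriplet_hat hbdd hpos hCPD
  obtain ⟨B, C, F, ht, -⟩ := hs.exists_isRepresentingTriplet hbdd hpos
  refine ⟨⟨(b, c, ν), hs, ?_⟩, ⟨(B, C, F), ht, ?_⟩, ?_⟩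
  · rintro ⟨b', c', ν'⟩ hs'
    obtain ⟨rfl, rfl, rfl⟩ := hs.unique hs'
    rfl
  · rintro ⟨B', C', F'⟩ ht'
    obtain ⟨rfl, rfl, rfl⟩ := ht.unique ht'
    rfl
  · intro b c ν B C F hs ht
    obtain ⟨hB, hC, hF⟩ := huniq hs ht
    refine ⟨hB, hC, hF, hC.isCompactOperator ?_⟩
    exact_mod_cast (Complex.continuous_ofReal.tendsto 0).comp hs.tendsto_div_hat
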